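/- Let $\beta>0$, let $m\ge 0$ and $n\ge 1$ be integers with $m\le n-1$, and let $l>0$ be deterministic. Let $B$ be the random $(m+1)\times(m+1)$ upper bidiagonal matrix with diagonal entries $x_1,\dots,x_m,0$ and superdiagonal entries $y_1,\dots,y_m$ (so the last row is zero), where all $x_j,y_j$ are independent, $x_j\sim\chi_{\beta(m-j+1)}$, $y_j\sim\chi_{\beta(n-j)}$ for $1\le j\le m$, and $\chi_k$ is the chi distribution with $k$ degrees of freedom. Let $\mathcal J$ be a random matrix with the law of $B^*B$ (that is, $\mathcal J$ belongs to the Laguerre $\beta$-ensemble $\mathrm{L}\beta\mathrm{E}_{(m,n)}$). Put $\mathcal J_{l,\times}=(I+i\,l\,e_1e_1^*)\mathcal J$, and count eigenvalues with algebraic multiplicity. Then, almost surely, $0$ is a simple eigenvalue of $\mathcal J_{l,\times}$, and the remaining $m$ eigenvalues $z_1,\dots,z_m$ form a point of $$S=\Big\{(z_j)_{j=1}^m\in(\mathbb C_+)^m:\ \sum_{j=1}^m\operatorname{Arg} z_j<\arctan l\Big\},$$ where $\mathbb C_+=\{\operatorname{Im} z>0\}$ and $\operatorname{Arg}$ is the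 principal argument. These eigenvalues have on $S$ the joint density $$\frac{l^{1-\beta n/2}}{C_{\beta,m,n}}\;e^{-\frac12\sum_{j=1}^m\operatorname{Re} z_j}\;\Big|\operatorname{Im}\prod_{j=1}^m z_j-l\,\operatorname{Re}\prod_{j=1}^m z_j\Big|^{\beta(n-m)/2-1}\prod_{j,k=1}^m|z_j-\bar z_k|^{\beta/2-1}\prod_{1\le j<k\le m}|z_j-z_k|^2$$ with respect to $d^2z_1\cdots d^2z_m$, where $C_{\beta,m,n}=t_{\beta,n,m}\,2^{m(\beta/2-1)}$, $a=|m-n|+1-2/\beta$ and $$t_{\beta,n,m}=\frac{2^{m(a\beta/2+1+(m-1)\beta/2)}\,\Gamma(\beta/2)^m}{\Gamma(\beta n/2)}\prod_{j=1}^m\frac{\Gamma(1+\beta j/2)\,\Gamma(1+\beta a/2+\beta(j-1)/2)}{\Gamma(1+\beta/2)}\;\Gamma(\beta(n-m)/2).$$ That is, this function is a symmetric probability density on $S$, and the unordered configuration (multiset) of the $m$ remaining eigenvalues has the law of $\{z_1,\dots,z_m\}$ for $(z_1,\dots,z_m)$ distributed on $S$ with this density. -/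

import Mathlib

open MeasureTheory ProbabilityTheory

noncomputable section

namespace LaguerreBeta

/-- The chi distribution with `k` degrees of freedom (`k > 0` real): the measure on `ℝ` with
Lebesgue density `x ^ (k - 1) * exp (-x ^ 2 / 2) / (2 ^ (k / 2 - 1) * Γ (k / 2))` on `(0, ∞)`. -/
def chi (k : ℝ) : Measure ℝ :=
  (volume.restrict (Set.Ioi 0)).withDensity fun x =>
    ENNReal.ofReal
      (x ^ (k - 1) * Real.exp (-x ^ 2 / 2) / ((2 : ℝ) ^ (k / 2 - 1) * Real.Gamma (k / 2)))

/-- The `(m + 1) × (m + 1)` upper bidiagonal matrix with diagonal `x₁, …, x_m, 0` and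
superdiagonal `y₁, …, y_m`; the last row is zero. -/
def bidiagonal {m : ℕ} (x y : Fin m → ℝ) : Matrix (Fin (m + 1)) (Fin (m + 1)) ℝ :=
  Matrix.of fun i j =>
    if h : (i : ℕ) < m then
      (if (j : ℕ) = (i : ℕ) then x ⟨i, h⟩ else if (j : ℕ) = (i : ℕ) + 1 then y ⟨i, h⟩ else 0)
    else 0

/-- The joint law of the bidiagonal entries `(x, y)` for `m < n`: all `2 * m` entries are
independent, `x_j ∼ χ_{β (m - j + 1)}` and `y_j ∼ χ_{β (n - j)}` for `1 ≤ j ≤ m`.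
The index `j : Fin m` starts at `0`, so that it stands for `j + 1`. -/
def coefficientLaw (β : ℝ) (m n : ℕ) : Measure ((Fin m → ℝ) × (Fin m → ℝ)) :=
  (Measure.pi fun j : Fin m => chi (β * ((m : ℝ) - ((j : ℕ) + 1) + 1))).prod
    (Measure.pi fun j : Fin m => chi (β * ((n : ℝ) - ((j : ℕ) + 1))))

/-- The Borel `σ`-algebra on real square matrices, generated by the entries. -/
instance matrixMeasurableSpace (N : ℕ) : MeasurableSpace (Matrix (Fin N) (Fin N) ℝ) :=
  inferInstanceAs (MeasurableSpace (Fin N → Fin N → ℝ))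

theorem measurable_bidiagonal_gram (m : ℕ) :
    Measurable fun c : (Fin m → ℝ) × (Fin m → ℝ) =>
      (bidiagonal c.1 c.2).transpose * bidiagonal c.1 c.2 := by
  refine measurable_pi_lambda _ fun i => measurable_pi_lambda _ fun j => ?_
  simp only [Matrix.mul_apply, Matrix.transpose_apply, bidiagonal, Matrix.of_apply]
  refine Finset.measurable_sum _ fun k _ => Measurable.mul ?_ ?_ <;>
    (split_ifs <;> fun_prop)

/-- The Laguerre `β`-ensemble `LβE_(m,n)` in the case `m < n`: the law of the
`(m + 1) × (m + 1)` real Jacobi matrix `B* B`, with `B` the random bidiagonal matrix above. -/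
def ensemble (β : ℝ) (m n : ℕ) : Measure (Matrix (Fin (m + 1)) (Fin (m + 1)) ℝ) :=
  (coefficientLaw β m n).map fun c => (bidiagonal c.1 c.2).transpose * bidiagonal c.1 c.2

/-- The multiplicative rank-one perturbation `(I + i l e₁ e₁*) J`. -/
def perturbed {m : ℕ} (l : ℝ) (J : Matrix (Fin (m + 1)) (Fin (m + 1)) ℝ) :
    Matrix (Fin (m + 1)) (Fin (m + 1)) ℂ :=
  (1 + (Complex.I * (l : ℂ)) •
      Matrix.vecMulVec (Pi.single 0 1 : Fin (m + 1) → ℂ) (star (Pi.single 0 1))) *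
    J.map (fun t : ℝ => (t : ℂ))

/-- The eigenvalues of a complex square matrix, with algebraic multiplicities. -/
def eigenvalues {N : ℕ} (A : Matrix (Fin N) (Fin N) ℂ) : Multiset ℂ :=
  A.charpoly.roots

/-- The unordered configuration (multiset) `{z₁, …, z_k}` underlying the tuple `z`. -/
def configuration {k : ℕ} (z : Fin k → ℂ) : Multiset ℂ :=
  Finset.univ.val.map z

/-- The usual `σ`-algebra on finite unordered configurations of points of `ℂ`: a set `A` of
configurations is measurable iff for every `k` the set of tuples in `ℂ ^ k` whose underlying
configuration belongs to `A` is Borel. -/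
instance configurationMeasurableSpace : MeasurableSpace (Multiset ℂ) :=
  ⨅ k : ℕ, MeasurableSpace.map (fun z : Fin k → ℂ => configuration z) inferInstance

theorem measurableSet_configurations_iff (A : Set (Multiset ℂ)) :
    MeasurableSet A ↔
      ∀ k : ℕ, MeasurableSet ((fun z : Fin k → ℂ => configuration z) ⁻¹' A) := by
  unfold configurationMeasurableSpace
  rw [MeasurableSpace.measurableSet_iInf]
  rfl

theorem measurable_configuration (k : ℕ) :
    Measurable (fun z : Fin k → ℂ => configuration z) := fun A hA =>
  (measurableSet_configurations_iff A).1 hA k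

/-- The set of all `z ∈ (ℂ₊)^m` with `∑ Arg z_j < arctan l`. -/
def region (m : ℕ) (l : ℝ) : Set (Fin m → ℂ) :=
  {z | (∀ j, 0 < (z j).im) ∧ ∑ j, (z j).arg < Real.arctan l}

/-- The parameter `a = |m - n| + 1 - 2 / β`. -/
def paramA (β : ℝ) (m n : ℕ) : ℝ :=
  |(m : ℝ) - (n : ℝ)| + 1 - 2 / β

/-- The constant `t_{β,n,m}`. -/
def constT (β : ℝ) (n m : ℕ) : ℝ :=
  (2 : ℝ) ^ ((m : ℝ) * (paramA β m n * β / 2 + 1 + ((m : ℝ) - 1) * β / 2)) *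
      Real.Gamma (β / 2) ^ m / Real.Gamma (β * n / 2) *
    (∏ j ∈ Finset.Icc 1 m,
      Real.Gamma (1 + β * (j : ℝ) / 2) *
          Real.Gamma (1 + β * paramA β m n / 2 + β * ((j : ℝ) - 1) / 2) /
        Real.Gamma (1 + β / 2)) *
    Real.Gamma (β * ((n : ℝ) - (m : ℝ)) / 2)

/-- The normalization constant `C_{β,m,n} = t_{β,n,m} 2 ^ (m (β / 2 - 1))`. -/
def constC (β : ℝ) (m n : ℕ) : ℝ :=
  constT β n m * (2 : ℝ) ^ ((m : ℝ) * (β / 2 - 1))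

/-- The joint density of `z₁, …, z_m` with respect to `d²z₁ ⋯ d²z_m`. -/
def density (β : ℝ) (m n : ℕ) (l : ℝ) (z : Fin m → ℂ) : ℝ :=
  l ^ (1 - β * (n : ℝ) / 2) / constC β m n *
    Real.exp (-(∑ j, (z j).re) / 2) *
    |(∏ j, z j).im - l * (∏ j, z j).re| ^ (β * ((n : ℝ) - (m : ℝ)) / 2 - 1) *
    (∏ j, ∏ k, ‖z j - (starRingEnd ℂ) (z k)‖ ^ (β / 2 - 1)) *
    ∏ j, ∏ k ∈ Finset.Ioi j, ‖z j - z k‖ ^ 2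

/-- The measure `density(z) d²z₁ ⋯ d²z_m` on the region. -/
def densityMeasure (β : ℝ) (m n : ℕ) (l : ℝ) : Measure (Fin m → ℂ) :=
  (volume.restrict (region m l)).withDensity fun z => ENNReal.ofReal (density β m n l z)

end LaguerreBeta

end

noncomputable section

namespace LaguerreBeta

open Polynomial

/-- The monic polynomial of degree `m` with lower coefficients `v`. -/
def monicOf {R : Type*} [CommRing R] {m : ℕ} (v : Fin m → R) : R[X] :=
  X ^ m + ∑ k : Fin m, C (v k) * X ^ (k : ℕ)

section monicOf
variable {R : Type*} [CommRing R] {m : ℕ}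

theorem degree_lower_lt [Nontrivial R] (v : Fin m → R) :
    (∑ k : Fin m, C (v k) * X ^ (k : ℕ)).degree < (m : WithBot ℕ) := by
  refine (Polynomial.degree_sum_le _ _).trans_lt ?_
  refine (Finset.sup_lt_iff (WithBot.bot_lt_coe m)).2 fun k _ => ?_
  exact (Polynomial.degree_C_mul_X_pow_le _ _).trans_lt (Nat.cast_lt.2 k.2)

theorem monic_monicOf (v : Fin m → R) : (monicOf v).Monic := by
  nontriviality R
  exact Polynomial.monic_X_pow_add (degree_lower_lt v)

theorem natDegree_monicOf [Nontrivial R] (v : Fin m → R) : (monicOf v).natDegree = m := by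
  have h : (monicOf v).degree = m := by
    rw [monicOf, Polynomial.degree_add_eq_left_of_degree_lt, degree_X_pow]
    simpa using degree_lower_lt v
  exact Polynomial.natDegree_eq_of_degree_eq_some h

theorem coeff_monicOf (v : Fin m → R) (k : Fin m) : (monicOf v).coeff k = v k := by
  rw [monicOf, coeff_add, coeff_X_pow, if_neg k.2.ne, zero_add, finsetSum_coeff,
    Finset.sum_eq_single k]
  · simp
  · intro j _ hj
    rw [coeff_C_mul, coeff_X_pow, if_neg (fun h => hj (Fin.ext h.symm)), mul_zero]
  · simp

theorem monicOf_injective : Function.Injective (monicOf : (Fin m → R) → R[X]) := fun v w h =>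
  funext fun k => by rw [← coeff_monicOf v k, h, coeff_monicOf]

theorem monicOf_coeff [Nontrivial R] {p : R[X]} (hp : p.Monic) (hd : p.natDegree = m) :
    monicOf (fun k : Fin m => p.coeff k) = p := by
  conv_rhs => rw [hp.as_sum, hd]
  rw [monicOf, Finset.sum_range fun i => C (p.coeff i) * X ^ i]

theorem map_monicOf {S : Type*} [CommRing S] (f : R →+* S) (v : Fin m → R) :
    (monicOf v).map f = monicOf (fun k => f (v k)) := by
  simp [monicOf, Polynomial.map_sum]

@[simp] theorem monicOf_zero (v : Fin 0 → R) : monicOf v = 1 := by simp [monicOf]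

theorem lower_cons_zero (v : Fin m → R) :
    ∑ k : Fin (m + 1), C ((Fin.cons 0 v : Fin (m + 1) → R) k) * X ^ (k : ℕ) =
      X * monicOf v - X ^ (m + 1) := by
  rw [Fin.sum_univ_succ, monicOf, mul_add, Finset.mul_sum]
  simp only [Fin.cons_zero, Fin.cons_succ, C_0, zero_mul, zero_add, Fin.val_succ]
  rw [← pow_succ', add_sub_cancel_left]
  exact Finset.sum_congr rfl fun k _ => by ring

theorem lower_snoc_one (v : Fin m → R) :
    ∑ k : Fin (m + 1), C ((Fin.snoc v 1 : Fin (m + 1) → R) k) * X ^ (k : ℕ) = monicOf v := by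
  rw [Fin.sum_univ_castSucc, monicOf]
  simp [add_comm]

end monicOf

/-- The lower coefficients `(p, s)` of the pair of monic polynomials attached to the squared
bidiagonal entries `(X, Y)`, where `s = z p' - Y s'` and `p = s - X p'`. -/
def pairCoeffs : (m : ℕ) → (Fin m → ℝ) × (Fin m → ℝ) → (Fin m → ℝ) × (Fin m → ℝ)
  | 0, c => c
  | m + 1, c =>
    let q := pairCoeffs m (Fin.tail c.1, Fin.tail c.2)
    let s : Fin (m + 1) → ℝ := Fin.cons 0 q.1 - c.2 0 • Fin.snoc q.2 1
    (s - c.1 0 • Fin.snoc q.1 1, s)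

/-- The inverse of `pairCoeffs` on positive entries. -/
def paramOf : (m : ℕ) → (Fin m → ℝ) × (Fin m → ℝ) → (Fin m → ℝ) × (Fin m → ℝ)
  | 0, q => q
  | m + 1, q =>
    let x : ℝ := q.2 (Fin.last m) - q.1 (Fin.last m)
    let p : Fin m → ℝ := fun k => (q.2 k.castSucc - q.1 k.castSucc) / x
    let y : ℝ := (Fin.cons 0 p : Fin (m + 1) → ℝ) (Fin.last m) - q.2 (Fin.last m)
    let s : Fin m → ℝ := fun k =>
      ((Fin.cons 0 p : Fin (m + 1) → ℝ) k.castSucc - q.2 k.castSucc) / y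
    (Fin.cons x (paramOf m (p, s)).1, Fin.cons y (paramOf m (p, s)).2)

/-- The pairs of tuples with positive entries. -/
def posSet (m : ℕ) : Set ((Fin m → ℝ) × (Fin m → ℝ)) :=
  {c | (∀ j, 0 < c.1 j) ∧ ∀ j, 0 < c.2 j}

/-- The polynomial `p` over `ℂ`. -/
def polyP {m : ℕ} (c : (Fin m → ℝ) × (Fin m → ℝ)) : ℂ[X] :=
  monicOf fun k => ((pairCoeffs m c).1 k : ℂ)

/-- The polynomial `s` over `ℂ`. -/
def polyS {m : ℕ} (c : (Fin m → ℝ) × (Fin m → ℝ)) : ℂ[X] :=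
  monicOf fun k => ((pairCoeffs m c).2 k : ℂ)

/-- The pair of tuples obtained by removing the first entries. -/
def tailPair {m : ℕ} (c : (Fin (m + 1) → ℝ) × (Fin (m + 1) → ℝ)) :
    (Fin m → ℝ) × (Fin m → ℝ) := (Fin.tail c.1, Fin.tail c.2)

theorem cons_ofReal {m : ℕ} (v : Fin m → ℝ) (k : Fin (m + 1)) :
    (((Fin.cons 0 v : Fin (m + 1) → ℝ) k : ℝ) : ℂ) =
      (Fin.cons 0 (fun k => (v k : ℂ)) : Fin (m + 1) → ℂ) k := by
  refine Fin.cases ?_ (fun k => ?_) k <;> simp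

theorem snoc_ofReal {m : ℕ} (v : Fin m → ℝ) (k : Fin (m + 1)) :
    (((Fin.snoc v 1 : Fin (m + 1) → ℝ) k : ℝ) : ℂ) =
      (Fin.snoc (fun k => (v k : ℂ)) 1 : Fin (m + 1) → ℂ) k := by
  refine Fin.lastCases ?_ (fun k => ?_) k <;> simp

theorem polyS_succ {m : ℕ} (c : (Fin (m + 1) → ℝ) × (Fin (m + 1) → ℝ)) :
    polyS c = X * polyP (tailPair c) - C (c.2 0 : ℂ) * polyS (tailPair c) := by
  have h1 := lower_cons_zero fun k => ((pairCoeffs m (tailPair c)).1 k : ℂ)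
  have h2 := lower_snoc_one fun k => ((pairCoeffs m (tailPair c)).2 k : ℂ)
  rw [polyS, polyP, polyS, ← h2, Finset.mul_sum]
  rw [eq_sub_iff_add_eq] at h1
  rw [← h1, monicOf]
  simp only [pairCoeffs, Pi.sub_apply, Pi.smul_apply, smul_eq_mul, Complex.ofReal_sub,
    Complex.ofReal_mul, cons_ofReal, snoc_ofReal, C_sub, C_mul, sub_mul, Finset.sum_sub_distrib,
    tailPair, mul_assoc]
  ring

theorem polyP_succ {m : ℕ} (c : (Fin (m + 1) → ℝ) × (Fin (m + 1) → ℝ)) :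
    polyP c = polyS c - C (c.1 0 : ℂ) * polyP (tailPair c) := by
  have h2 := lower_snoc_one fun k => ((pairCoeffs m (tailPair c)).1 k : ℂ)
  rw [polyS]
  rw [polyP, polyP, ← h2, Finset.mul_sum, monicOf, monicOf]
  simp only [pairCoeffs, Pi.sub_apply, Pi.smul_apply, smul_eq_mul, Complex.ofReal_sub,
    Complex.ofReal_mul, cons_ofReal, snoc_ofReal, C_sub, C_mul, sub_mul, Finset.sum_sub_distrib,
    tailPair, mul_assoc]
  ring

@[simp] theorem polyP_zero (c : (Fin 0 → ℝ) × (Fin 0 → ℝ)) : polyP c = 1 := by simp [polyP]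
@[simp] theorem polyS_zero (c : (Fin 0 → ℝ) × (Fin 0 → ℝ)) : polyS c = 1 := by simp [polyS]

theorem tailPair_mem_posSet {m : ℕ} {c : (Fin (m + 1) → ℝ) × (Fin (m + 1) → ℝ)}
    (hc : c ∈ posSet (m + 1)) : tailPair c ∈ posSet m :=
  ⟨fun j => hc.1 j.succ, fun j => hc.2 j.succ⟩

/-- The complex coefficients of `p - i l (s - p)`. -/
def mixedCoeffs {m : ℕ} (l : ℝ) (q : (Fin m → ℝ) × (Fin m → ℝ)) : Fin m → ℂ :=
  fun k => q.1 k - Complex.I * l * (q.2 k - q.1 k)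

theorem monicOf_mixedCoeffs {m : ℕ} (l : ℝ) (c : (Fin m → ℝ) × (Fin m → ℝ)) :
    monicOf (mixedCoeffs l (pairCoeffs m c)) =
      polyP c - C (Complex.I * l) * (polyS c - polyP c) := by
  simp only [monicOf, mixedCoeffs, polyP, polyS, C_sub, C_mul, sub_mul, mul_sub,
    Finset.sum_sub_distrib, Finset.mul_sum, mul_add, mul_assoc]
  ring

theorem paramOf_pairCoeffs : ∀ {m : ℕ} {c : (Fin m → ℝ) × (Fin m → ℝ)}, c ∈ posSet m →
    paramOf m (pairCoeffs m c) = c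
  | 0, _, _ => rfl
  | m + 1, c, hc => by
    have ih := paramOf_pairCoeffs (tailPair_mem_posSet hc)
    have hx := (hc.1 0).ne'
    have hy := (hc.2 0).ne'
    simp only [tailPair] at ih
    simp only [paramOf, pairCoeffs, Pi.sub_apply, Pi.smul_apply, smul_eq_mul, Fin.snoc_last,
      Fin.snoc_castSucc, mul_one, sub_sub_cancel, mul_div_cancel_left₀ _ hx,
      mul_div_cancel_left₀ _ hy, Prod.mk.eta]
    rw [ih]
    simp [Fin.cons_self_tail]

theorem continuous_pairCoeffs : ∀ m : ℕ, Continuous (pairCoeffs m)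
  | 0 => continuous_id
  | m + 1 => by
    have ih := continuous_pairCoeffs m
    have ht : Continuous fun c : (Fin (m + 1) → ℝ) × (Fin (m + 1) → ℝ) =>
        pairCoeffs m (Fin.tail c.1, Fin.tail c.2) :=
      ih.comp (by unfold Fin.tail; fun_prop)
    have h1 : Continuous fun c : (Fin (m + 1) → ℝ) × (Fin (m + 1) → ℝ) => c.1 0 := by fun_prop
    have h2 : Continuous fun c : (Fin (m + 1) → ℝ) × (Fin (m + 1) → ℝ) => c.2 0 := by fun_prop
    have hs : Continuous fun c : (Fin (m + 1) → ℝ) × (Fin (m + 1) → ℝ) =>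
        (Fin.cons 0 (pairCoeffs m (Fin.tail c.1, Fin.tail c.2)).1 : Fin (m + 1) → ℝ) -
          c.2 0 • (Fin.snoc (pairCoeffs m (Fin.tail c.1, Fin.tail c.2)).2 1 : Fin (m + 1) → ℝ) := by
      refine Continuous.sub ?_ (h2.smul ?_)
      · exact continuous_const.finCons ht.fst
      · exact ht.snd.finSnoc continuous_const
    exact (hs.sub (h1.smul (ht.fst.finSnoc continuous_const))).prodMk hs

/-- The set of all pairs `(p, s)` that come from positive entries. -/
def pairSet (m : ℕ) : Set ((Fin m → ℝ) × (Fin m → ℝ)) := pairCoeffs m '' posSet m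

theorem paramOf_mem_posSet {m : ℕ} {q : (Fin m → ℝ) × (Fin m → ℝ)} (hq : q ∈ pairSet m) :
    paramOf m q ∈ posSet m := by
  obtain ⟨c, hc, rfl⟩ := hq
  rwa [paramOf_pairCoeffs hc]

theorem pairCoeffs_paramOf {m : ℕ} {q : (Fin m → ℝ) × (Fin m → ℝ)} (hq : q ∈ pairSet m) :
    pairCoeffs m (paramOf m q) = q := by
  obtain ⟨c, hc, rfl⟩ := hq
  rw [paramOf_pairCoeffs hc]

/-- One step of the recursion defining `pairCoeffs`. -/
def pairStep {m : ℕ} (x y : ℝ) (q : (Fin m → ℝ) × (Fin m → ℝ)) :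
    (Fin (m + 1) → ℝ) × (Fin (m + 1) → ℝ) :=
  ((Fin.cons 0 q.1 - y • Fin.snoc q.2 1 : Fin (m + 1) → ℝ) - x • Fin.snoc q.1 1,
    Fin.cons 0 q.1 - y • Fin.snoc q.2 1)

theorem pairCoeffs_succ {m : ℕ} (c : (Fin (m + 1) → ℝ) × (Fin (m + 1) → ℝ)) :
    pairCoeffs (m + 1) c = pairStep (c.1 0) (c.2 0) (pairCoeffs m (tailPair c)) := rfl

/-- The entry `X` recovered from a pair. -/
def headX {m : ℕ} (q : (Fin (m + 1) → ℝ) × (Fin (m + 1) → ℝ)) : ℝ :=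
  q.2 (Fin.last m) - q.1 (Fin.last m)

/-- The reduced polynomial `p'` recovered from a pair. -/
def lowerP {m : ℕ} (q : (Fin (m + 1) → ℝ) × (Fin (m + 1) → ℝ)) : Fin m → ℝ :=
  fun k => (q.2 k.castSucc - q.1 k.castSucc) / headX q

/-- The entry `Y` recovered from a pair. -/
def headY {m : ℕ} (q : (Fin (m + 1) → ℝ) × (Fin (m + 1) → ℝ)) : ℝ :=
  (Fin.cons 0 (lowerP q) : Fin (m + 1) → ℝ) (Fin.last m) - q.2 (Fin.last m)

/-- The reduced polynomial `s'` recovered from a pair. -/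
def lowerS {m : ℕ} (q : (Fin (m + 1) → ℝ) × (Fin (m + 1) → ℝ)) : Fin m → ℝ :=
  fun k => ((Fin.cons 0 (lowerP q) : Fin (m + 1) → ℝ) k.castSucc - q.2 k.castSucc) / headY q

theorem headX_pairStep {m : ℕ} (x y : ℝ) (q : (Fin m → ℝ) × (Fin m → ℝ)) :
    headX (pairStep x y q) = x := by
  simp [headX, pairStep]

theorem lowerP_pairStep {m : ℕ} {x : ℝ} (hx : x ≠ 0) (y : ℝ) (q : (Fin m → ℝ) × (Fin m → ℝ)) :
    lowerP (pairStep x y q) = q.1 := by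
  ext k
  rw [lowerP, headX_pairStep]
  simp [pairStep, hx]

theorem headY_pairStep {m : ℕ} {x : ℝ} (hx : x ≠ 0) (y : ℝ) (q : (Fin m → ℝ) × (Fin m → ℝ)) :
    headY (pairStep x y q) = y := by
  rw [headY, lowerP_pairStep hx]
  simp [pairStep]

theorem lowerS_pairStep {m : ℕ} {x y : ℝ} (hx : x ≠ 0) (hy : y ≠ 0)
    (q : (Fin m → ℝ) × (Fin m → ℝ)) : lowerS (pairStep x y q) = q.2 := by
  ext k
  rw [lowerS, headY_pairStep hx, lowerP_pairStep hx]
  simp [pairStep, hy]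

theorem pairStep_lower {m : ℕ} {q : (Fin (m + 1) → ℝ) × (Fin (m + 1) → ℝ)} (hx : headX q ≠ 0)
    (hy : headY q ≠ 0) : pairStep (headX q) (headY q) (lowerP q, lowerS q) = q := by
  have h2 : (Fin.cons 0 (lowerP q) - headY q • Fin.snoc (lowerS q) 1 : Fin (m + 1) → ℝ) = q.2 := by
    ext k
    refine Fin.lastCases ?_ (fun k => ?_) k
    · simp [headY]
    · simp only [Pi.sub_apply, Pi.smul_apply, Fin.snoc_castSucc, smul_eq_mul, lowerS]
      rw [mul_div_cancel₀ _ hy, sub_sub_cancel]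
  refine Prod.ext ?_ h2
  simp only [pairStep]
  rw [h2]
  ext k
  refine Fin.lastCases ?_ (fun k => ?_) k
  · simp [headX]
  · simp only [Pi.sub_apply, Pi.smul_apply, Fin.snoc_castSucc, smul_eq_mul, lowerP]
    rw [mul_div_cancel₀ _ hx, sub_sub_cancel]

theorem mem_pairSet_succ {m : ℕ} {q : (Fin (m + 1) → ℝ) × (Fin (m + 1) → ℝ)} :
    q ∈ pairSet (m + 1) ↔ 0 < headX q ∧ 0 < headY q ∧ (lowerP q, lowerS q) ∈ pairSet m := by
  constructor
  · rintro ⟨c, hc, rfl⟩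
    have hx := hc.1 0
    have hy := hc.2 0
    rw [pairCoeffs_succ, headX_pairStep, headY_pairStep hx.ne', lowerP_pairStep hx.ne',
      lowerS_pairStep hx.ne' hy.ne']
    exact ⟨hx, hy, _, tailPair_mem_posSet hc, rfl⟩
  · rintro ⟨hx, hy, c, hc, h⟩
    refine ⟨(Fin.cons (headX q) c.1, Fin.cons (headY q) c.2), ⟨?_, ?_⟩, ?_⟩
    · exact fun j => Fin.cases hx hc.1 j
    · exact fun j => Fin.cases hy hc.2 j
    · rw [pairCoeffs_succ]
      simp only [tailPair, Fin.tail_cons, Fin.cons_zero, Prod.mk.eta]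
      rw [h, pairStep_lower hx.ne' hy.ne']

theorem pairStep_mem_pairSet {m : ℕ} {x y : ℝ} (hx : 0 < x) (hy : 0 < y)
    (q : (Fin m → ℝ) × (Fin m → ℝ)) : pairStep x y q ∈ pairSet (m + 1) ↔ q ∈ pairSet m := by
  rw [mem_pairSet_succ, headX_pairStep, headY_pairStep hx.ne', lowerP_pairStep hx.ne',
    lowerS_pairStep hx.ne' hy.ne']
  simp [hx, hy]

theorem isOpen_pairSet : ∀ m : ℕ, IsOpen (pairSet m)
  | 0 => by
    have : pairSet 0 = Set.univ := Set.eq_univ_of_forall fun q => ⟨q, by simp [posSet], rfl⟩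
    simp [this]
  | m + 1 => by
    have ih := isOpen_pairSet m
    have hX : Continuous (headX : (Fin (m + 1) → ℝ) × (Fin (m + 1) → ℝ) → ℝ) := by
      unfold headX; fun_prop
    rw [isOpen_iff_mem_nhds]
    intro q hq
    obtain ⟨h1, h2, h3⟩ := mem_pairSet_succ.1 hq
    have hP : ContinuousAt (lowerP : (Fin (m + 1) → ℝ) × (Fin (m + 1) → ℝ) → Fin m → ℝ) q :=
      continuousAt_pi.2 fun k => ContinuousAt.div (by fun_prop) hX.continuousAt h1.ne'
    have hc : ContinuousAt (fun q : (Fin (m + 1) → ℝ) × (Fin (m + 1) → ℝ) =>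
        (Fin.cons 0 (lowerP q) : Fin (m + 1) → ℝ)) q := continuousAt_const.finCons hP
    have hc' := continuousAt_pi.1 hc
    have hY : ContinuousAt (headY : (Fin (m + 1) → ℝ) × (Fin (m + 1) → ℝ) → ℝ) q :=
      (hc' _).sub (by fun_prop)
    have hS : ContinuousAt (lowerS : (Fin (m + 1) → ℝ) × (Fin (m + 1) → ℝ) → Fin m → ℝ) q :=
      continuousAt_pi.2 fun k => ContinuousAt.div ((hc' _).sub (by fun_prop)) hY h2.ne'
    filter_upwards [hX.continuousAt.eventually (lt_mem_nhds h1), hY.eventually (lt_mem_nhds h2),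
      (hP.prodMk hS).eventually (ih.mem_nhds h3)] with r r1 r2 r3
    exact mem_pairSet_succ.2 ⟨r1, r2, r3⟩

theorem measurable_finCons {m : ℕ} : Measurable fun v : ℝ × (Fin m → ℝ) =>
    (Fin.cons v.1 v.2 : Fin (m + 1) → ℝ) :=
  (continuous_fst.finCons continuous_snd).measurable

theorem measurable_paramOf : ∀ m : ℕ, Measurable (paramOf m)
  | 0 => measurable_id
  | m + 1 => by
    have ih := measurable_paramOf m
    have hX : Measurable (headX : (Fin (m + 1) → ℝ) × (Fin (m + 1) → ℝ) → ℝ) := by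
      unfold headX; fun_prop
    have hP : Measurable (lowerP : (Fin (m + 1) → ℝ) × (Fin (m + 1) → ℝ) → Fin m → ℝ) := by
      unfold lowerP; fun_prop
    have hc : Measurable (fun q : (Fin (m + 1) → ℝ) × (Fin (m + 1) → ℝ) =>
        (Fin.cons 0 (lowerP q) : Fin (m + 1) → ℝ)) :=
      measurable_finCons.comp (measurable_const.prodMk hP)
    have hY : Measurable (headY : (Fin (m + 1) → ℝ) × (Fin (m + 1) → ℝ) → ℝ) := by
      unfold headY; fun_prop
    have hS : Measurable (lowerS : (Fin (m + 1) → ℝ) × (Fin (m + 1) → ℝ) → Fin m → ℝ) := by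
      unfold lowerS; fun_prop
    have hr := ih.comp (hP.prodMk hS)
    exact (measurable_finCons.comp (hX.prodMk hr.fst)).prodMk
      (measurable_finCons.comp (hY.prodMk hr.snd))

/-- The monic polynomial with roots `z`. -/
def rootPoly {m : ℕ} (z : Fin m → ℂ) : ℂ[X] := ∏ j, (X - C (z j))

/-- The lower coefficients of the monic polynomial with roots `z`. -/
def rootCoeffs {m : ℕ} (z : Fin m → ℂ) : Fin m → ℂ := fun k => (rootPoly z).coeff k

theorem monic_rootPoly {m : ℕ} (z : Fin m → ℂ) : (rootPoly z).Monic :=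
  monic_prod_of_monic _ _ fun j _ => monic_X_sub_C (z j)

theorem natDegree_rootPoly {m : ℕ} (z : Fin m → ℂ) : (rootPoly z).natDegree = m := by
  rw [rootPoly, natDegree_prod_of_monic _ _ fun j _ => monic_X_sub_C (z j)]
  simp

theorem monicOf_rootCoeffs {m : ℕ} (z : Fin m → ℂ) : monicOf (rootCoeffs z) = rootPoly z :=
  monicOf_coeff (monic_rootPoly z) (natDegree_rootPoly z)

theorem roots_rootPoly {m : ℕ} (z : Fin m → ℂ) : (rootPoly z).roots = configuration z := by
  rw [← Polynomial.roots_multiset_prod_X_sub_C (configuration z), configuration, Multiset.map_map]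
  rfl

theorem exists_configuration_eq {m : ℕ} (M : Multiset ℂ) (h : M.card = m) :
    ∃ z : Fin m → ℂ, configuration z = M := by
  induction M using Quotient.inductionOn with
  | h L =>
    subst h
    exact ⟨L.get, by
      change Multiset.map L.get Finset.univ.val = (L : Multiset ℂ)
      rw [Fin.univ_val_map, List.ofFn_get]⟩

theorem exists_rootPoly_eq {m : ℕ} {p : ℂ[X]} (hp : p.Monic) (hd : p.natDegree = m) :
    ∃ z : Fin m → ℂ, rootPoly z = p := by
  have hs := IsAlgClosed.splits p
  obtain ⟨z, hz⟩ := exists_configuration_eq p.roots (hs.natDegree_eq_card_roots.symm.trans hd)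
  refine ⟨z, ?_⟩
  conv_rhs => rw [hs.eq_prod_roots_of_monic hp, ← hz, configuration, Multiset.map_map]
  rfl

theorem exists_rootCoeffs_eq {m : ℕ} (v : Fin m → ℂ) : ∃ z : Fin m → ℂ, rootCoeffs z = v := by
  obtain ⟨z, hz⟩ := exists_rootPoly_eq (monic_monicOf v) (natDegree_monicOf v)
  exact ⟨z, monicOf_injective (by rw [monicOf_rootCoeffs, hz])⟩

theorem hasFDerivAt_coeff_prod {m : ℕ} (s : Finset (Fin m)) (z₀ : Fin m → ℂ) (k : ℕ) :
    HasFDerivAt (fun z : Fin m → ℂ => (∏ j ∈ s, (X - C (z j))).coeff k)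
      (∑ j ∈ s, (-(∏ i ∈ s.erase j, (X - C (z₀ i))).coeff k) •
        (ContinuousLinearMap.proj j : (Fin m → ℂ) →L[ℂ] ℂ)) z₀ := by
  induction s using Finset.induction_on generalizing k with
  | empty => simpa using hasFDerivAt_const _ _
  | insert a s ha ih =>
    have hpa : HasFDerivAt (fun z : Fin m → ℂ => z a)
        (ContinuousLinearMap.proj a : (Fin m → ℂ) →L[ℂ] ℂ) z₀ :=
      (ContinuousLinearMap.proj a : (Fin m → ℂ) →L[ℂ] ℂ).hasFDerivAt
    have he : ∀ j ∈ s, (insert a s).erase j = insert a (s.erase j) := fun j hj =>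
      Finset.erase_insert_of_ne (fun h => ha (h ▸ hj))
    have hn : ∀ j, a ∉ s.erase j := fun j h => ha (Finset.mem_of_mem_erase h)
    cases k with
    | zero =>
      have h := (hpa.mul (ih 0)).neg
      refine (h.congr_of_eventuallyEq (Filter.Eventually.of_forall fun z => ?_)).congr_fderiv ?_
      · simp [Finset.prod_insert ha, sub_mul]
      · rw [Finset.sum_insert ha, Finset.erase_insert ha]
        ext v
        simp only [neg_apply, add_apply,
          smul_apply, sum_apply, smul_eq_mul,
          ContinuousLinearMap.proj_apply]
        rw [neg_add, Finset.mul_sum, ← Finset.sum_neg_distrib, add_comm, neg_mul]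
        congr 1
        refine Finset.sum_congr rfl fun j hj => ?_
        rw [he j hj, Finset.prod_insert (hn j)]
        simp [sub_mul]
        ring
    | succ k =>
      have h := (ih k).sub (hpa.mul (ih (k + 1)))
      refine (h.congr_of_eventuallyEq (Filter.Eventually.of_forall fun z => ?_)).congr_fderiv ?_
      · simp [Finset.prod_insert ha, sub_mul, coeff_X_mul]
      · rw [Finset.sum_insert ha, Finset.erase_insert ha]
        ext v
        simp only [sub_apply, add_apply,
          smul_apply, sum_apply, smul_eq_mul,
          ContinuousLinearMap.proj_apply]
        rw [← sub_sub, Finset.mul_sum, ← Finset.sum_sub_distrib, sub_eq_add_neg, add_comm, neg_mul]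
        congr 1
        refine Finset.sum_congr rfl fun j hj => ?_
        rw [he j hj, Finset.prod_insert (hn j)]
        simp [sub_mul, coeff_X_mul]
        ring

/-- The Jacobian matrix of `rootCoeffs`. -/
def rootMatrix {m : ℕ} (z : Fin m → ℂ) : Matrix (Fin m) (Fin m) ℂ :=
  Matrix.of fun k j => -(∏ i ∈ Finset.univ.erase j, (X - C (z i))).coeff k

/-- The derivative of `rootCoeffs`. -/
def rootDeriv {m : ℕ} (z : Fin m → ℂ) : (Fin m → ℂ) →L[ℂ] (Fin m → ℂ) :=
  LinearMap.toContinuousLinearMap (Matrix.toLin' (rootMatrix z))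

theorem hasFDerivAt_rootCoeffs {m : ℕ} (z : Fin m → ℂ) :
    HasFDerivAt rootCoeffs (rootDeriv z) z := by
  refine hasFDerivAt_pi'.2 fun k => ?_
  refine (hasFDerivAt_coeff_prod Finset.univ z k).congr_fderiv ?_
  ext v
  simp [rootDeriv, Matrix.mulVec, dotProduct, rootMatrix]

theorem continuous_rootCoeffs {m : ℕ} : Continuous (rootCoeffs : (Fin m → ℂ) → Fin m → ℂ) :=
  continuous_iff_continuousAt.2 fun z => (hasFDerivAt_rootCoeffs z).continuousAt

theorem vandermonde_mul_rootMatrix {m : ℕ} (z : Fin m → ℂ) :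
    Matrix.vandermonde z * rootMatrix z =
      Matrix.diagonal fun i => -∏ k ∈ Finset.univ.erase i, (z i - z k) := by
  ext i j
  have hd : (∏ i ∈ Finset.univ.erase j, (X - C (z i))).natDegree < m := by
    rw [natDegree_prod_of_monic _ _ fun j _ => monic_X_sub_C (z j)]
    have : 0 < m := j.pos
    simp [this]
  have he : (Matrix.vandermonde z * rootMatrix z) i j =
      -(∏ k ∈ Finset.univ.erase j, (X - C (z k))).eval (z i) := by
    rw [eval_eq_sum_range' hd, Matrix.mul_apply, Finset.sum_range, ← Finset.sum_neg_distrib]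
    exact Finset.sum_congr rfl fun k _ => by
      simp [Matrix.vandermonde_apply, rootMatrix, mul_comm]
  rw [he, eval_prod, Matrix.diagonal_apply]
  simp only [eval_sub, eval_X, eval_C]
  split_ifs with h
  · rw [h]
  · rw [neg_eq_zero]
    exact Finset.prod_eq_zero (Finset.mem_erase.2 ⟨h, Finset.mem_univ i⟩) (sub_self _)

theorem prod_erase_norm {m : ℕ} (z : Fin m → ℂ) :
    ∏ i, ∏ k ∈ Finset.univ.erase i, ‖z i - z k‖ = ∏ i, ∏ k ∈ Finset.Ioi i, ‖z i - z k‖ ^ 2 := by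
  have h1 : ∀ i : Fin m, ∏ k ∈ Finset.univ.erase i, ‖z i - z k‖ =
      (∏ k ∈ Finset.Ioi i, ‖z i - z k‖) * ∏ k ∈ Finset.Iio i, ‖z i - z k‖ := fun i => by
    rw [← Finset.prod_union]
    · congr 1
      ext k
      simp [ne_comm, lt_or_lt_iff_ne]
    · exact Finset.disjoint_left.2 fun k h1 h2 =>
        lt_asymm (Finset.mem_Ioi.1 h1) (Finset.mem_Iio.1 h2)
  have h2 : ∏ i, ∏ k ∈ Finset.Iio i, ‖z i - z k‖ = ∏ i, ∏ k ∈ Finset.Ioi i, ‖z i - z k‖ := by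
    rw [Finset.prod_comm' (t' := Finset.univ) (s' := fun i => Finset.Ioi i) (by simp)]
    simp_rw [norm_sub_rev]
  simp_rw [h1, Finset.prod_mul_distrib, h2, Finset.prod_pow, sq]

theorem norm_det_rootMatrix {m : ℕ} {z : Fin m → ℂ} (hz : Function.Injective z) :
    ‖(rootMatrix z).det‖ ^ 2 = ∏ i, ∏ k ∈ Finset.Ioi i, ‖z i - z k‖ ^ 2 := by
  have h := congrArg (fun A => ‖Matrix.det A‖) (vandermonde_mul_rootMatrix z)
  simp only [Matrix.det_mul, Matrix.det_diagonal, norm_mul, norm_prod, norm_neg] at h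
  rw [prod_erase_norm] at h
  have hv : ‖(Matrix.vandermonde z).det‖ = ∏ i, ∏ k ∈ Finset.Ioi i, ‖z i - z k‖ := by
    rw [Matrix.det_vandermonde]
    simp_rw [norm_prod, norm_sub_rev]
  have hv0 : ‖(Matrix.vandermonde z).det‖ ≠ 0 :=
    norm_ne_zero_iff.2 (Matrix.det_vandermonde_ne_zero_iff.2 hz)
  simp_rw [Finset.prod_pow] at h ⊢
  rw [← hv] at h ⊢
  rw [sq, mul_right_inj' hv0] at h
  rw [h]

theorem abs_det_rootDeriv {m : ℕ} {z : Fin m → ℂ} (hz : Function.Injective z) :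
    |((rootDeriv z).restrictScalars ℝ).det| = ∏ i, ∏ k ∈ Finset.Ioi i, ‖z i - z k‖ ^ 2 := by
  rw [← norm_det_rootMatrix hz]
  have : ((rootDeriv z).restrictScalars ℝ).det = Complex.normSq (rootMatrix z).det := by
    rw [ContinuousLinearMap.det, ContinuousLinearMap.coe_restrictScalars,
      LinearMap.det_restrictScalars, Algebra.norm_complex_eq]
    simp [rootDeriv]
  rw [this, Complex.normSq_eq_norm_sq, abs_of_nonneg (by positivity)]

theorem rootCoeffs_comp_perm {m : ℕ} (z : Fin m → ℂ) (σ : Equiv.Perm (Fin m)) :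
    rootCoeffs (z ∘ σ) = rootCoeffs z := by
  have : rootPoly (z ∘ σ) = rootPoly z :=
    Equiv.prod_comp σ fun j => X - C (z j)
  unfold rootCoeffs
  rw [this]

/-- The tuples with strictly increasing real parts. -/
def orderedSet (m : ℕ) : Set (Fin m → ℂ) := {z | StrictMono fun j => (z j).re}

theorem injOn_rootCoeffs {m : ℕ} : Set.InjOn (rootCoeffs (m := m)) (orderedSet m) := by
  intro z hz w hw h
  have hc : configuration z = configuration w := by
    rw [← roots_rootPoly, ← roots_rootPoly, ← monicOf_rootCoeffs, ← monicOf_rootCoeffs, h]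
  have hmem : ∀ x, (∃ j, z j = x) ↔ ∃ j, w j = x := fun x => by
    have h1 : x ∈ configuration z ↔ x ∈ configuration w := by rw [hc]
    simpa [configuration] using h1
  have hre : (fun j => (z j).re) = fun j => (w j).re := by
    refine (StrictMono.range_inj hz hw).1 (Set.ext fun t => ⟨?_, ?_⟩)
    · rintro ⟨j, rfl⟩
      obtain ⟨k, hk⟩ := (hmem (z j)).1 ⟨j, rfl⟩
      exact ⟨k, by simp [hk]⟩
    · rintro ⟨j, rfl⟩
      obtain ⟨k, hk⟩ := (hmem (w j)).2 ⟨j, rfl⟩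
      exact ⟨k, by simp [hk]⟩
  funext j
  obtain ⟨k, hk⟩ := (hmem (z j)).1 ⟨j, rfl⟩
  have : k = j := hw.injective (by
    have := congrFun hre j
    rw [hk]
    exact this)
  rw [← hk, this]

theorem measurableSet_orderedSet (m : ℕ) : MeasurableSet (orderedSet m) := by
  have : orderedSet m = ⋂ (i : Fin m) (j : Fin m) (_ : i < j), {z | (z i).re < (z j).re} := by
    ext z
    simp [orderedSet, StrictMono]
  rw [this]
  exact MeasurableSet.iInter fun i => MeasurableSet.iInter fun j => MeasurableSet.iInter fun _ =>
    measurableSet_lt (by fun_prop) (by fun_prop)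

/-- The tuples with two equal real parts. -/
def tieSet (m : ℕ) : Set (Fin m → ℂ) := {z | ¬ Function.Injective fun j => (z j).re}

theorem volume_tieSet (m : ℕ) : volume (tieSet m) = 0 := by
  have hsub : tieSet m ⊆ ⋃ (i : Fin m) (j : Fin m) (_ : i ≠ j),
      {z : Fin m → ℂ | (z i).re = (z j).re} := by
    intro z hz
    simp only [tieSet, Function.Injective, Set.mem_ofPred_eq, not_forall] at hz
    obtain ⟨i, j, h, hne⟩ := hz
    simp only [Set.mem_iUnion]
    exact ⟨i, j, hne, h⟩
  refine measure_mono_null hsub ?_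
  refine measure_iUnion_null fun i => measure_iUnion_null fun j => measure_iUnion_null fun hij => ?_
  let f : (Fin m → ℂ) →ₗ[ℝ] ℝ :=
    Complex.reLm ∘ₗ (LinearMap.proj i : (Fin m → ℂ) →ₗ[ℝ] ℂ) -
      Complex.reLm ∘ₗ (LinearMap.proj j : (Fin m → ℂ) →ₗ[ℝ] ℂ)
  have hf : {z : Fin m → ℂ | (z i).re = (z j).re} = LinearMap.ker f := by
    ext z
    simp [f, sub_eq_zero]
  rw [hf]
  refine Measure.addHaar_submodule _ _ fun h => ?_
  have h1 : f (Pi.single i 1) = 0 := by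
    rw [← LinearMap.mem_ker, h]
    trivial
  simp [f, hij.symm] at h1

theorem exists_perm_mem_orderedSet {m : ℕ} {z : Fin m → ℂ} (hz : z ∉ tieSet m) :
    ∃ σ : Equiv.Perm (Fin m), z ∘ σ ∈ orderedSet m := by
  refine ⟨Tuple.sort fun j => (z j).re, ?_⟩
  have hi : Function.Injective fun j => (z j).re := not_not.1 hz
  exact (Tuple.monotone_sort fun j => (z j).re).strictMono_of_injective
    (hi.comp (Equiv.injective _))

theorem measurePreserving_comp_perm {m : ℕ} (σ : Equiv.Perm (Fin m)) :
    MeasurePreserving (fun z : Fin m → ℂ => z ∘ σ) := by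
  have h := volume_measurePreserving_piCongrLeft (fun _ : Fin m => ℂ) σ.symm
  have he : (fun z : Fin m → ℂ => z ∘ σ) =
      MeasurableEquiv.piCongrLeft (fun _ : Fin m => ℂ) σ.symm := by
    funext z j
    have := Equiv.piCongrLeft_apply_apply (fun _ : Fin m => ℂ) σ.symm z (σ j)
    rw [Equiv.symm_apply_apply] at this
    exact this.symm
  rw [he]
  exact h

theorem setLIntegral_eq_factorial_mul {m : ℕ} {S : Set (Fin m → ℂ)} (hS : MeasurableSet S)
    (hSσ : ∀ σ : Equiv.Perm (Fin m), ∀ z, z ∘ σ ∈ S ↔ z ∈ S) {φ : (Fin m → ℂ) → ENNReal}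
    (hφσ : ∀ σ : Equiv.Perm (Fin m), ∀ z, φ (z ∘ σ) = φ z) :
    ∫⁻ z in S, φ z = (m.factorial : ENNReal) * ∫⁻ z in S ∩ orderedSet m, φ z := by
  let D : Equiv.Perm (Fin m) → Set (Fin m → ℂ) := fun σ =>
    (fun z : Fin m → ℂ => z ∘ σ) ⁻¹' (S ∩ orderedSet m)
  have hmD : MeasurableSet (S ∩ orderedSet m) := hS.inter (measurableSet_orderedSet m)
  have hD : ∀ σ, MeasurableSet (D σ) := fun σ =>
    (measurePreserving_comp_perm σ).measurable hmD
  have hdisj : Pairwise (Function.onFun Disjoint D) := by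
    intro σ τ hστ
    refine Set.disjoint_left.2 fun z h1 h2 => hστ ?_
    have e1 : StrictMono fun j => (z (σ j)).re := h1.2
    have e2 : StrictMono fun j => (z (τ j)).re := h2.2
    have e : (fun j => (z (σ j)).re) = fun j => (z (τ j)).re := by
      refine (StrictMono.range_inj e1 e2).1 ?_
      rw [show (fun j => (z (σ j)).re) = (fun j => (z j).re) ∘ σ from rfl,
        show (fun j => (z (τ j)).re) = (fun j => (z j).re) ∘ τ from rfl,
        σ.surjective.range_comp, τ.surjective.range_comp]
    have hinj : Function.Injective fun j => (z j).re := by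
      intro a b hab
      have : σ.symm a = σ.symm b := e1.injective (by simpa using hab)
      exact σ.symm.injective this
    exact Equiv.ext fun j => hinj (congrFun e j)
  have hae : S =ᵐ[volume] ⋃ σ, D σ := by
    have hsub : ⋃ σ, D σ ⊆ S := Set.iUnion_subset fun σ z hz => (hSσ σ z).1 hz.1
    refine (ae_eq_set.2 ⟨?_, by simp [Set.sdiff_eq_empty.2 hsub]⟩)
    refine measure_mono_null ?_ (volume_tieSet m)
    intro z hz
    by_contra hn
    obtain ⟨σ, hσ⟩ := exists_perm_mem_orderedSet hn
    exact hz.2 (Set.mem_iUnion.2 ⟨σ, (hSσ σ z).2 hz.1, hσ⟩)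
  rw [setLIntegral_congr hae, lintegral_iUnion hD hdisj, tsum_fintype]
  have : ∀ σ, ∫⁻ z in D σ, φ z = ∫⁻ z in S ∩ orderedSet m, φ z := fun σ => by
    rw [← (measurePreserving_comp_perm σ).setLIntegral_comp_preimage_emb ?_ φ (S ∩ orderedSet m)]
    · simp_rw [hφσ]
      rfl
    · let E : (Fin m → ℂ) ≃ᵐ (Fin m → ℂ) :=
        ⟨⟨fun z => z ∘ σ, fun z => z ∘ σ.symm, fun z => by ext; simp, fun z => by ext; simp⟩,
          (measurePreserving_comp_perm σ).measurable,
          (measurePreserving_comp_perm σ.symm).measurable⟩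
      exact E.measurableEmbedding
  simp_rw [this]
  simp [Fintype.card_perm]

theorem eval_rootPoly {m : ℕ} (z : Fin m → ℂ) (t : ℂ) :
    (rootPoly z).eval t = ∏ j, (t - z j) := by
  simp [rootPoly, eval_prod]

theorem norm_prod_eval_rootPoly {m n : ℕ} (a : Fin m → ℂ) (b : Fin n → ℂ) :
    ‖∏ j, (rootPoly b).eval (a j)‖ = ‖∏ k, (rootPoly a).eval (b k)‖ := by
  simp_rw [eval_rootPoly, norm_prod]
  rw [Finset.prod_comm]
  simp_rw [norm_sub_rev]

theorem eval_polyS_succ {m : ℕ} (c : (Fin (m + 1) → ℝ) × (Fin (m + 1) → ℝ)) (t : ℂ) :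
    (polyS c).eval t =
      t * (polyP (tailPair c)).eval t - c.2 0 * (polyS (tailPair c)).eval t := by
  simp [polyS_succ]

theorem eval_polyP_succ {m : ℕ} (c : (Fin (m + 1) → ℝ) × (Fin (m + 1) → ℝ)) (t : ℂ) :
    (polyP c).eval t = (polyS c).eval t - c.1 0 * (polyP (tailPair c)).eval t := by
  simp [polyP_succ]

/-- The modulus of the resultant of `p` and `s`. -/
def resultantNorm {m : ℕ} (c : (Fin m → ℝ) × (Fin m → ℝ)) : ℝ :=
  ∏ j : Fin m, (|c.1 j| ^ (m - (j : ℕ)) * |c.2 j| ^ (m - 1 - (j : ℕ)))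

theorem resultantNorm_succ {m : ℕ} (c : (Fin (m + 1) → ℝ) × (Fin (m + 1) → ℝ)) :
    resultantNorm c = |c.1 0| ^ (m + 1) * |c.2 0| ^ m * resultantNorm (tailPair c) := by
  rw [resultantNorm, Fin.prod_univ_succ]
  congr 1
  refine Finset.prod_congr rfl fun j _ => ?_
  have h1 : m + 1 - ((j.succ : Fin (m + 1)) : ℕ) = m - j := by simp
  have h2 : m + 1 - 1 - ((j.succ : Fin (m + 1)) : ℕ) = m - 1 - j := by simp; omega
  rw [h1, h2]
  rfl

theorem norm_prod_eval_polyS : ∀ {m : ℕ} (c : (Fin m → ℝ) × (Fin m → ℝ)) (w : Fin m → ℂ),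
    rootPoly w = polyP c → ‖∏ j, (polyS c).eval (w j)‖ = resultantNorm c
  | 0, c, w, _ => by simp [resultantNorm]
  | m + 1, c, w, hw => by
    obtain ⟨u, hu⟩ := exists_rootPoly_eq (p := polyP (tailPair c)) (monic_monicOf _)
      (natDegree_monicOf _)
    have ih := norm_prod_eval_polyS (tailPair c) u hu
    have h1 : ∀ j, (polyS c).eval (w j) = c.1 0 * (rootPoly u).eval (w j) := fun j => by
      have h : (polyP c).eval (w j) = 0 := by
        rw [← hw, eval_rootPoly]
        exact Finset.prod_eq_zero (Finset.mem_univ j) (sub_self _)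
      rw [eval_polyP_succ] at h
      rw [hu]
      linear_combination h
    have h2 : ∀ k, (rootPoly w).eval (u k) = -c.2 0 * (polyS (tailPair c)).eval (u k) := fun k => by
      have h : (polyP (tailPair c)).eval (u k) = 0 := by
        rw [← hu, eval_rootPoly]
        exact Finset.prod_eq_zero (Finset.mem_univ k) (sub_self _)
      rw [hw, eval_polyP_succ, eval_polyS_succ, h]
      ring
    simp_rw [h1, Finset.prod_mul_distrib, norm_mul]
    rw [norm_prod_eval_rootPoly]
    simp_rw [h2, Finset.prod_mul_distrib, norm_mul]
    rw [ih, resultantNorm_succ]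
    simp
    ring

theorem map_conj_polyP {m : ℕ} (c : (Fin m → ℝ) × (Fin m → ℝ)) :
    (polyP c).map (starRingEnd ℂ) = polyP c := by
  simp [polyP, map_monicOf]

theorem map_conj_polyS {m : ℕ} (c : (Fin m → ℝ) × (Fin m → ℝ)) :
    (polyS c).map (starRingEnd ℂ) = polyS c := by
  simp [polyS, map_monicOf]

/-- The polynomial `p - i l (s - p)`, whose roots are the nonzero eigenvalues. -/
def polyF {m : ℕ} (l : ℝ) (c : (Fin m → ℝ) × (Fin m → ℝ)) : ℂ[X] :=
  polyP c - C (Complex.I * l) * (polyS c - polyP c)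

theorem eval_polyF {m : ℕ} (l : ℝ) (c : (Fin m → ℝ) × (Fin m → ℝ)) (t : ℂ) :
    (polyF l c).eval t =
      (polyP c).eval t - Complex.I * l * ((polyS c).eval t - (polyP c).eval t) := by
  simp [polyF]

theorem map_conj_polyF {m : ℕ} (l : ℝ) (c : (Fin m → ℝ) × (Fin m → ℝ)) :
    (polyF l c).map (starRingEnd ℂ) = polyF (-l) c := by
  simp [polyF, map_conj_polyP, map_conj_polyS]

theorem rootPoly_conj {m : ℕ} (z : Fin m → ℂ) :
    rootPoly (fun j => starRingEnd ℂ (z j)) = (rootPoly z).map (starRingEnd ℂ) := by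
  simp [rootPoly, Polynomial.map_prod]

theorem prod_norm_sub_conj {m : ℕ} {l : ℝ} {c : (Fin m → ℝ) × (Fin m → ℝ)} {z : Fin m → ℂ}
    (hz : rootPoly z = polyF l c) :
    ∏ j, ∏ k, ‖z j - starRingEnd ℂ (z k)‖ = (2 * |l|) ^ m * resultantNorm c := by
  cases m with
  | zero => simp [resultantNorm]
  | succ m =>
    have hzc : rootPoly (fun j => starRingEnd ℂ (z j)) = polyF (-l) c := by
      rw [rootPoly_conj, hz, map_conj_polyF]
    obtain ⟨u, hu⟩ := exists_rootPoly_eq (p := polyP (tailPair c)) (monic_monicOf _)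
      (natDegree_monicOf _)
    have e1 : ∏ j, ∏ k, ‖z j - starRingEnd ℂ (z k)‖ =
        ‖∏ k, (rootPoly z).eval (starRingEnd ℂ (z k))‖ := by
      simp_rw [eval_rootPoly, norm_prod]
      rw [Finset.prod_comm]
      simp_rw [norm_sub_rev]
    have h1 : ∀ k, (rootPoly z).eval (starRingEnd ℂ (z k)) =
        -2 * Complex.I * l * c.1 0 * (rootPoly u).eval (starRingEnd ℂ (z k)) := fun k => by
      have h : (polyF (-l) c).eval (starRingEnd ℂ (z k)) = 0 := by
        rw [← hzc, eval_rootPoly]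
        exact Finset.prod_eq_zero (Finset.mem_univ k) (sub_self _)
      rw [hz, hu]
      rw [eval_polyF] at h ⊢
      have h' := eval_polyP_succ c (starRingEnd ℂ (z k))
      push_cast at h
      linear_combination h + 2 * Complex.I * l * h'
    have h2 : ∀ k, (rootPoly fun j => starRingEnd ℂ (z j)).eval (u k) =
        -c.2 0 * (polyS (tailPair c)).eval (u k) := fun k => by
      have h : (polyP (tailPair c)).eval (u k) = 0 := by
        rw [← hu, eval_rootPoly]
        exact Finset.prod_eq_zero (Finset.mem_univ k) (sub_self _)
      rw [hzc, eval_polyF, eval_polyP_succ, eval_polyS_succ, h]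
      ring
    rw [e1]
    simp_rw [h1, Finset.prod_mul_distrib, norm_mul]
    rw [norm_prod_eval_rootPoly]
    simp_rw [h2, Finset.prod_mul_distrib, norm_mul]
    rw [norm_prod_eval_polyS _ _ hu, resultantNorm_succ]
    simp
    ring

theorem cons_zero_pairCoeffs_last : ∀ {m : ℕ} (c : (Fin m → ℝ) × (Fin m → ℝ)),
    (Fin.cons 0 (pairCoeffs m c).1 : Fin (m + 1) → ℝ) (Fin.last m) = -(∑ j, c.1 j + ∑ j, c.2 j)
  | 0, c => by simp [Fin.last]
  | m + 1, c => by
    have ih := cons_zero_pairCoeffs_last (tailPair c)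
    rw [← Fin.succ_last, Fin.cons_succ, Fin.sum_univ_succ, Fin.sum_univ_succ, pairCoeffs_succ,
      pairStep]
    simp only [Pi.sub_apply, Pi.smul_apply, Fin.snoc_last, ih, smul_eq_mul, mul_one]
    simp only [tailPair, Fin.tail]
    ring

theorem sum_re_roots {m : ℕ} {l : ℝ} {c : (Fin m → ℝ) × (Fin m → ℝ)} {z : Fin m → ℂ}
    (hz : rootCoeffs z = mixedCoeffs l (pairCoeffs m c)) :
    ∑ j, (z j).re = ∑ j, c.1 j + ∑ j, c.2 j := by
  cases m with
  | zero => simp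
  | succ m =>
    have h1 := prod_X_sub_C_coeff_card_pred (Finset.univ : Finset (Fin (m + 1))) z (by simp)
    have h2 := cons_zero_pairCoeffs_last c
    rw [← Fin.succ_last, Fin.cons_succ] at h2
    have h3 := congrArg Complex.re (congrFun hz (Fin.last m))
    rw [Finset.card_univ, Fintype.card_fin, Nat.add_sub_cancel] at h1
    simp only [rootCoeffs, rootPoly, Fin.val_last, mixedCoeffs, h1] at h3
    simp [h2] at h3
    linarith

theorem eval_polyS_zero : ∀ {m : ℕ} (c : (Fin m → ℝ) × (Fin m → ℝ)),
    (polyS c).eval 0 = (-1) ^ m * ((∏ j, c.2 j : ℝ) : ℂ)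
  | 0, c => by simp
  | m + 1, c => by
    rw [eval_polyS_succ, eval_polyS_zero (tailPair c), Fin.prod_univ_succ]
    simp only [tailPair, Fin.tail]
    push_cast
    ring

theorem eval_ofReal_polyP {m : ℕ} (c : (Fin m → ℝ) × (Fin m → ℝ)) (t : ℝ) :
    ∃ a : ℝ, (polyP c).eval (t : ℂ) = a :=
  ⟨(monicOf (pairCoeffs m c).1).eval t, by simp [polyP, monicOf, eval_finsetSum]⟩

theorem abs_im_sub_mul_re_prod {m : ℕ} {l : ℝ} {c : (Fin m → ℝ) × (Fin m → ℝ)} {z : Fin m → ℂ}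
    (hz : rootPoly z = polyF l c) :
    |(∏ j, z j).im - l * (∏ j, z j).re| = |l| * ∏ j, |c.2 j| := by
  obtain ⟨a, ha⟩ := eval_ofReal_polyP c 0
  have h1 : ∏ j, z j = (-1) ^ m * (polyF l c).eval 0 := by
    rw [← hz, eval_rootPoly]
    simp only [zero_sub, Finset.prod_neg]
    rw [Finset.card_univ, Fintype.card_fin, ← mul_assoc, ← mul_pow]
    simp
  rw [eval_polyF, eval_polyS_zero] at h1
  rw [Complex.ofReal_zero] at ha
  rw [ha] at h1
  rw [← Finset.abs_prod, ← abs_mul]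
  rcases neg_one_pow_eq_or ℂ m with h | h <;> rw [h] at h1 <;> rw [h1] <;>
    simp only [one_mul, neg_mul, Complex.sub_im, Complex.neg_im, Complex.neg_re, Complex.sub_re,
      Complex.mul_im, Complex.mul_re, Complex.ofReal_re, Complex.ofReal_im, Complex.I_re,
      Complex.I_im]
  · rw [abs_eq_abs]; right; ring
  · rw [abs_eq_abs]; right; ring

/-! ### The roots lie in the region -/

theorem polyP_polyS_ne_zero : ∀ {m : ℕ} {c : (Fin m → ℝ) × (Fin m → ℝ)}, c ∈ posSet m →
    ∀ t : ℂ, ¬ ((polyP c).eval t = 0 ∧ (polyS c).eval t = 0)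
  | 0, c, _, t => by simp
  | m + 1, c, hc, t => by
    rintro ⟨h1, h2⟩
    refine polyP_polyS_ne_zero (tailPair_mem_posSet hc) t ?_
    have hx : (c.1 0 : ℂ) ≠ 0 := Complex.ofReal_ne_zero.2 (hc.1 0).ne'
    have hy : (c.2 0 : ℂ) ≠ 0 := Complex.ofReal_ne_zero.2 (hc.2 0).ne'
    rw [eval_polyP_succ, h2, zero_sub, neg_eq_zero] at h1
    have h3 := (mul_eq_zero.1 h1).resolve_left hx
    rw [eval_polyS_succ, h3, mul_zero, zero_sub, neg_eq_zero] at h2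
    exact ⟨h3, (mul_eq_zero.1 h2).resolve_left hy⟩

theorem im_polyS_mul_conj_polyP : ∀ {m : ℕ} {c : (Fin m → ℝ) × (Fin m → ℝ)}, c ∈ posSet m →
    ∀ {t : ℂ}, t.im < 0 →
      0 ≤ ((polyS c).eval t * starRingEnd ℂ ((polyP c).eval t)).im ∧ (polyP c).eval t ≠ 0
  | 0, c, _, t, _ => by simp
  | m + 1, c, hc, t, ht => by
    obtain ⟨h1, h2⟩ := im_polyS_mul_conj_polyP (tailPair_mem_posSet hc) ht
    have hx := hc.1 0
    have hy := hc.2 0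
    have h3 : 0 < Complex.normSq ((polyP (tailPair c)).eval t) := Complex.normSq_pos.2 h2
    have h4 : ((polyS c).eval t * starRingEnd ℂ ((polyP c).eval t)).im =
        c.1 0 * (-t.im * Complex.normSq ((polyP (tailPair c)).eval t) + c.2 0 *
          ((polyS (tailPair c)).eval t * starRingEnd ℂ ((polyP (tailPair c)).eval t)).im) := by
      rw [eval_polyP_succ, eval_polyS_succ, Complex.normSq_apply]
      simp only [Complex.mul_im, Complex.mul_re, Complex.sub_re, Complex.sub_im, Complex.conj_re,
        Complex.conj_im, Complex.ofReal_re, Complex.ofReal_im, map_sub, map_mul]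
      ring
    have h5 : 0 < ((polyS c).eval t * starRingEnd ℂ ((polyP c).eval t)).im := by
      rw [h4]
      exact mul_pos hx (add_pos_of_pos_of_nonneg (mul_pos (neg_pos.2 ht) h3)
        (mul_nonneg hy.le h1))
    refine ⟨h5.le, fun h => ?_⟩
    rw [h] at h5
    simp at h5

theorem im_root_pos {m : ℕ} {l : ℝ} (hl : 0 < l) {c : (Fin m → ℝ) × (Fin m → ℝ)}
    (hc : c ∈ posSet m) {t : ℂ} (ht : (polyF l c).eval t = 0) : 0 < t.im := by
  rw [eval_polyF] at ht
  by_contra! hn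
  rcases hn.lt_or_eq with hn | hn
  · obtain ⟨h1, h2⟩ := im_polyS_mul_conj_polyP hc hn
    have h3 : 0 < Complex.normSq ((polyP c).eval t) := Complex.normSq_pos.2 h2
    have h4 := congrArg (fun w => (w * starRingEnd ℂ ((polyP c).eval t)).re) ht
    rw [Complex.normSq_apply] at h3
    simp only [Complex.mul_im, Complex.mul_re, Complex.sub_re, Complex.sub_im, Complex.conj_re,
      Complex.conj_im, Complex.ofReal_re, Complex.ofReal_im, Complex.I_re, Complex.I_im,
      Complex.zero_re, Complex.zero_im] at h4 h1
    have h5 := mul_nonneg hl.le h1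
    nlinarith
  · have hconj : starRingEnd ℂ t = t := Complex.conj_eq_iff_im.2 hn
    have hP : starRingEnd ℂ ((polyP c).eval t) = (polyP c).eval t := by
      rw [← Polynomial.eval₂_at_apply, ← Polynomial.eval_map, map_conj_polyP, hconj]
    have hS : starRingEnd ℂ ((polyS c).eval t) = (polyS c).eval t := by
      rw [← Polynomial.eval₂_at_apply, ← Polynomial.eval_map, map_conj_polyS, hconj]
    have h2 := congrArg (starRingEnd ℂ) ht
    simp only [map_sub, map_mul, hP, hS, Complex.conj_I, Complex.conj_ofReal, map_zero] at h2
    have h3 : (polyP c).eval t = 0 := by linear_combination (ht + h2) / 2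
    have h4 : (polyS c).eval t = 0 := by
      rw [h3, zero_sub, neg_eq_zero, sub_zero] at ht
      exact (mul_eq_zero.1 ht).resolve_left
        (mul_ne_zero Complex.I_ne_zero (Complex.ofReal_ne_zero.2 hl.ne'))
    exact polyP_polyS_ne_zero hc t ⟨h3, h4⟩

theorem eval_neg_real : ∀ {m : ℕ} {c : (Fin m → ℝ) × (Fin m → ℝ)}, c ∈ posSet m →
    ∀ {τ : ℝ}, 0 ≤ τ → ∃ a d : ℝ, (polyP c).eval (-τ : ℂ) = (-1) ^ m * a ∧
      (polyS c).eval (-τ : ℂ) = (-1) ^ m * d ∧ 0 < d ∧ d ≤ a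
  | 0, c, _, τ, _ => ⟨1, 1, by simp⟩
  | m + 1, c, hc, τ, hτ => by
    obtain ⟨a, d, h1, h2, h3, h4⟩ := eval_neg_real (tailPair_mem_posSet hc) hτ
    have hx := hc.1 0
    have hy := hc.2 0
    refine ⟨τ * a + c.2 0 * d + c.1 0 * a, τ * a + c.2 0 * d, ?_, ?_, ?_, ?_⟩
    · rw [eval_polyP_succ, eval_polyS_succ, h1, h2]
      push_cast
      ring
    · rw [eval_polyS_succ, h1, h2]
      push_cast
      ring
    · have := mul_pos hy h3
      have := mul_nonneg hτ (h3.le.trans h4)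
      linarith
    · have := mul_nonneg hx.le (h3.le.trans h4)
      linarith

theorem prod_eq_norm_mul_exp {m : ℕ} (z : Fin m → ℂ) :
    ∏ j, z j = ((∏ j, ‖z j‖ : ℝ) : ℂ) * Complex.exp ((∑ j, (z j).arg : ℝ) * Complex.I) := by
  push_cast
  rw [Finset.sum_mul, Complex.exp_sum, ← Finset.prod_mul_distrib]
  exact Finset.prod_congr rfl fun j _ => (Complex.norm_mul_exp_arg_mul_I (z j)).symm

theorem roots_mem_region {m : ℕ} {l : ℝ} (hl : 0 < l) {c : (Fin m → ℝ) × (Fin m → ℝ)}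
    (hc : c ∈ posSet m) {z : Fin m → ℂ} (hz : rootPoly z = polyF l c) : z ∈ region m l := by
  have him : ∀ j, 0 < (z j).im := fun j => im_root_pos hl hc (by
    rw [← hz, eval_rootPoly]
    exact Finset.prod_eq_zero (Finset.mem_univ j) (sub_self _))
  refine ⟨him, ?_⟩
  have key : ∀ τ : ℝ, 0 ≤ τ → ∃ N : ℝ, 0 ≤ N ∧
      0 < N * Real.cos (∑ j, (z j + τ).arg) ∧
      N * Real.sin (∑ j, (z j + τ).arg) < l * (N * Real.cos (∑ j, (z j + τ).arg)) := by
    intro τ hτ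
    obtain ⟨a, d, h1, h2, h3, h4⟩ := eval_neg_real hc hτ
    have h5 : ∏ j, (z j + τ) = a - Complex.I * l * (d - a) := by
      have h6 : ∏ j, (z j + τ) = (-1) ^ m * (polyF l c).eval (-τ : ℂ) := by
        rw [← hz, eval_rootPoly]
        have : ∀ j, (-τ : ℂ) - z j = -(z j + τ) := fun j => by ring
        simp_rw [this, Finset.prod_neg]
        rw [Finset.card_univ, Fintype.card_fin, ← mul_assoc, ← mul_pow]
        simp
      rw [h6, eval_polyF, h1, h2]
      rcases neg_one_pow_eq_or ℂ m with h | h <;> rw [h] <;> ring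
    rw [prod_eq_norm_mul_exp fun j => z j + τ] at h5
    have hre := congrArg Complex.re h5
    have hi := congrArg Complex.im h5
    rw [Complex.re_ofReal_mul, Complex.exp_ofReal_mul_I_re] at hre
    rw [Complex.im_ofReal_mul, Complex.exp_ofReal_mul_I_im] at hi
    refine ⟨∏ j, ‖z j + τ‖, Finset.prod_nonneg fun j _ => norm_nonneg _, ?_, ?_⟩
    · rw [hre]
      simp
      linarith
    · rw [hre, hi]
      simp
      nlinarith
  have hpos : ∀ τ : ℝ, 0 ≤ ∑ j, (z j + τ).arg := fun τ =>
    Finset.sum_nonneg fun j _ => Complex.arg_nonneg_iff.2 (by simpa using (him j).le)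
  have hcont : Continuous fun τ : ℝ => ∑ j, (z j + τ).arg := by
    refine continuous_finsetSum _ fun j _ => continuous_iff_continuousAt.2 fun τ => ?_
    refine ContinuousAt.comp (f := fun τ : ℝ => z j + τ) (Complex.continuousAt_arg ?_)
      (by fun_prop)
    exact Complex.mem_slitPlane_iff.2 (Or.inr (by simpa using (him j).ne'))
  have hlim : Filter.Tendsto (fun τ : ℝ => ∑ j, (z j + τ).arg) Filter.atTop (nhds 0) := by
    rw [← Finset.sum_const_zero (s := (Finset.univ : Finset (Fin m)))]
    refine tendsto_finsetSum _ fun j _ => ?_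
    have h1 : Filter.Tendsto (fun τ : ℝ => ((τ⁻¹ : ℝ) : ℂ) * z j + 1) Filter.atTop (nhds 1) := by
      have := ((Complex.continuous_ofReal.tendsto 0).comp
        (tendsto_inv_atTop_zero (𝕜 := ℝ))).mul_const (z j) |>.add_const 1
      simpa using this
    have h2 := (Complex.continuousAt_arg Complex.one_mem_slitPlane).tendsto.comp h1
    rw [Complex.arg_one] at h2
    refine h2.congr' ?_
    filter_upwards [Filter.eventually_gt_atTop (0 : ℝ)] with τ hτ
    have : z j + τ = (τ : ℂ) * (((τ⁻¹ : ℝ) : ℂ) * z j + 1) := by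
      have : (τ : ℂ) ≠ 0 := Complex.ofReal_ne_zero.2 hτ.ne'
      push_cast
      field_simp
    rw [this, Complex.arg_real_mul _ hτ]
    rfl
  have hlt : ∑ j, (z j + (0 : ℝ)).arg < Real.pi / 2 := by
    by_contra! hge
    obtain ⟨T, hT, hT0⟩ := ((hlim.eventually (gt_mem_nhds (half_pos Real.pi_pos))).and
      (Filter.eventually_ge_atTop (0 : ℝ))).exists
    obtain ⟨τ, hτ, hτ'⟩ := intermediate_value_Icc' hT0 hcont.continuousOn ⟨hT.le, hge⟩
    obtain ⟨N, _, hN, _⟩ := key τ hτ.1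
    simp only at hτ'
    rw [hτ', Real.cos_pi_div_two, mul_zero] at hN
    exact lt_irrefl _ hN
  have h0 := hpos 0
  obtain ⟨N, hN0, hN1, hN2⟩ := key 0 le_rfl
  simp only [Complex.ofReal_zero, add_zero] at hlt h0 hN1 hN2
  have hN : 0 < N := lt_of_le_of_ne hN0 fun h => by simp [← h] at hN1
  have hcos : 0 < Real.cos (∑ j, (z j).arg) := (pos_iff_pos_of_mul_pos hN1).1 hN
  have htan : Real.tan (∑ j, (z j).arg) < l := by
    rw [Real.tan_eq_sin_div_cos, div_lt_iff₀ hcos]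
    nlinarith
  rw [← Real.arctan_tan (by linarith [Real.pi_pos]) hlt]
  exact Real.arctan_strictMono htan

/-- The pair `(p, s)` recovered from the coefficients of `p - i l (s - p)`. -/
def unmix {m : ℕ} (l : ℝ) (v : Fin m → ℂ) : (Fin m → ℝ) × (Fin m → ℝ) :=
  (fun k => (v k).re, fun k => (v k).re - (v k).im / l)

theorem unmix_mixedCoeffs {m : ℕ} {l : ℝ} (hl : l ≠ 0) (q : (Fin m → ℝ) × (Fin m → ℝ)) :
    unmix l (mixedCoeffs l q) = q := by
  refine Prod.ext (funext fun k => ?_) (funext fun k => ?_)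
  · simp [unmix, mixedCoeffs]
  · simp [unmix, mixedCoeffs]
    field_simp
    ring

theorem mixedCoeffs_unmix {m : ℕ} {l : ℝ} (hl : l ≠ 0) (v : Fin m → ℂ) :
    mixedCoeffs l (unmix l v) = v := by
  funext k
  refine Complex.ext ?_ ?_
  · simp [unmix, mixedCoeffs]
  · simp [unmix, mixedCoeffs]
    field_simp

theorem continuous_unmix {m : ℕ} (l : ℝ) : Continuous (unmix (m := m) l) := by
  unfold unmix
  fun_prop

theorem continuous_mixedCoeffs {m : ℕ} (l : ℝ) : Continuous (mixedCoeffs (m := m) l) := by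
  unfold mixedCoeffs
  fun_prop

theorem rootPoly_eq_polyF_iff {m : ℕ} {l : ℝ} {c : (Fin m → ℝ) × (Fin m → ℝ)} {z : Fin m → ℂ} :
    rootPoly z = polyF l c ↔ rootCoeffs z = mixedCoeffs l (pairCoeffs m c) := by
  rw [polyF, ← monicOf_mixedCoeffs, ← monicOf_rootCoeffs]
  exact monicOf_injective.eq_iff

theorem isPreconnected_region (m : ℕ) (l : ℝ) : IsPreconnected (region m l) := by
  let K : Set (Fin m → ℂ) := {w | (∀ j, 0 < (w j).im) ∧ ∑ j, (w j).im < Real.arctan l}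
  have hK : Convex ℝ K := by
    intro w hw u hu a b ha hb hab
    have e : ∀ j, ((a • w + b • u) j).im = a * (w j).im + b * (u j).im := fun j => by simp
    refine ⟨fun j => ?_, ?_⟩
    · rw [e]
      exact convex_Ioi (0 : ℝ) (hw.1 j) (hu.1 j) ha hb hab
    · simp_rw [e, Finset.sum_add_distrib, ← Finset.mul_sum]
      exact convex_Iio (Real.arctan l) hw.2 hu.2 ha hb hab
  have hlt : ∀ w ∈ K, ∀ j, (w j).im < Real.pi / 2 := fun w hw j =>
    ((Finset.single_le_sum (f := fun j => (w j).im) (fun i _ => (hw.1 i).le)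
      (Finset.mem_univ j)).trans_lt hw.2).trans (Real.arctan_lt_pi_div_two l)
  have himage : region m l = (fun (w : Fin m → ℂ) j => Complex.exp (w j)) '' K := by
    ext z
    constructor
    · rintro ⟨h1, h2⟩
      have hz : ∀ j, z j ≠ 0 := fun j h => by simpa [h] using h1 j
      refine ⟨fun j => Complex.log (z j), ⟨fun j => ?_, by simpa only [Complex.log_im] using h2⟩,
        funext fun j => Complex.exp_log (hz j)⟩
      rw [Complex.log_im]
      exact lt_of_le_of_ne (Complex.arg_nonneg_iff.2 (h1 j).le) fun h =>
        (h1 j).ne' (Complex.arg_eq_zero_iff.1 h.symm).2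
    · rintro ⟨w, hw, rfl⟩
      have harg : ∀ j, (Complex.exp (w j)).arg = (w j).im := fun j => by
        rw [← Complex.log_im, Complex.log_exp]
        · linarith [hw.1 j, Real.pi_pos]
        · linarith [hlt w hw j, Real.pi_pos]
      refine ⟨fun j => ?_, by simpa only [harg] using hw.2⟩
      rw [Complex.exp_im]
      exact mul_pos (Real.exp_pos _) (Real.sin_pos_of_pos_of_lt_pi (hw.1 j)
        (by linarith [hlt w hw j, Real.pi_pos]))
  rw [himage]
  exact hK.isPreconnected.image _ (by fun_prop)

theorem im_sub_mul_re_prod_neg {m : ℕ} {l : ℝ} {z : Fin m → ℂ}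
    (hz : z ∈ region m l) : (∏ j, z j).im - l * (∏ j, z j).re < 0 := by
  have hz0 : ∀ j, z j ≠ 0 := fun j h => by simpa [h] using hz.1 j
  have hN : 0 < ∏ j, ‖z j‖ := Finset.prod_pos fun j _ => norm_pos_iff.2 (hz0 j)
  have h0 : 0 ≤ ∑ j, (z j).arg :=
    Finset.sum_nonneg fun j _ => Complex.arg_nonneg_iff.2 (hz.1 j).le
  have hlt : ∑ j, (z j).arg < Real.pi / 2 := hz.2.trans (Real.arctan_lt_pi_div_two l)
  have hcos : 0 < Real.cos (∑ j, (z j).arg) :=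
    Real.cos_pos_of_mem_Ioo ⟨by linarith [Real.pi_pos], hlt⟩
  have htan : Real.tan (∑ j, (z j).arg) < l := by
    rw [← Real.tan_arctan l]
    exact Real.tan_lt_tan_of_lt_of_lt_pi_div_two (by linarith [Real.pi_pos])
      (Real.arctan_lt_pi_div_two l) hz.2
  rw [Real.tan_eq_sin_div_cos, div_lt_iff₀ hcos] at htan
  rw [prod_eq_norm_mul_exp, Complex.re_ofReal_mul, Complex.exp_ofReal_mul_I_re,
    Complex.im_ofReal_mul, Complex.exp_ofReal_mul_I_im]
  nlinarith

theorem resultantNorm_ne_zero {m : ℕ} {c : (Fin m → ℝ) × (Fin m → ℝ)} (h : resultantNorm c ≠ 0)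
    (j : Fin m) : c.1 j ≠ 0 := by
  intro hj
  refine h (Finset.prod_eq_zero (Finset.mem_univ j) ?_)
  rw [hj, abs_zero, zero_pow (by have := j.2; omega), zero_mul]

theorem mem_posSet_of_mem_region {m : ℕ} {l : ℝ} {c : (Fin m → ℝ) × (Fin m → ℝ)}
    (h1 : ∀ j, 0 ≤ c.1 j) (h2 : ∀ j, 0 ≤ c.2 j) {z : Fin m → ℂ} (hz : z ∈ region m l)
    (hzc : rootPoly z = polyF l c) : c ∈ posSet m := by
  refine ⟨fun j => lt_of_le_of_ne (h1 j) (Ne.symm ?_), fun j => lt_of_le_of_ne (h2 j) (Ne.symm ?_)⟩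
  · refine resultantNorm_ne_zero (fun h => ?_) j
    have h3 := prod_norm_sub_conj hzc
    rw [h, mul_zero, Finset.prod_eq_zero_iff] at h3
    obtain ⟨i, _, hi⟩ := h3
    obtain ⟨k, _, hk⟩ := Finset.prod_eq_zero_iff.1 hi
    have h4 := congrArg Complex.im (sub_eq_zero.1 (norm_eq_zero.1 hk))
    rw [Complex.conj_im] at h4
    linarith [hz.1 i, hz.1 k]
  · intro hj
    have h3 := abs_im_sub_mul_re_prod hzc
    have h4 : ∏ j, |c.2 j| = 0 := Finset.prod_eq_zero (Finset.mem_univ j) (by rw [hj, abs_zero])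
    rw [h4, mul_zero, abs_eq_zero] at h3
    exact (im_sub_mul_re_prod_neg hz).ne h3

theorem unmix_rootCoeffs_mem_pairSet {m : ℕ} {l : ℝ} (hl : 0 < l) {z : Fin m → ℂ}
    (hz : z ∈ region m l) : unmix l (rootCoeffs z) ∈ pairSet m := by
  let u : Set (Fin m → ℂ) := (fun z => unmix l (rootCoeffs z)) ⁻¹' pairSet m
  have hcont : Continuous fun z : Fin m → ℂ => unmix l (rootCoeffs z) :=
    (continuous_unmix l).comp continuous_rootCoeffs
  have hu : IsOpen u := (isOpen_pairSet m).preimage hcont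
  suffices h : region m l ⊆ u from h hz
  refine (isPreconnected_region m l).subset_of_closure_inter_subset hu ?_ ?_
  · let c : (Fin m → ℝ) × (Fin m → ℝ) := (fun _ => 1, fun _ => 1)
    have hc : c ∈ posSet m := ⟨fun _ => one_pos, fun _ => one_pos⟩
    obtain ⟨w, hw⟩ := exists_rootCoeffs_eq (mixedCoeffs l (pairCoeffs m c))
    refine ⟨w, roots_mem_region hl hc (rootPoly_eq_polyF_iff.2 hw), c, hc, ?_⟩
    simp only [hw]
    rw [unmix_mixedCoeffs hl.ne']
  · rintro z₀ ⟨hz₀, hr⟩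
    obtain ⟨w, hw, hlim⟩ := mem_closure_iff_seq_limit.1 hz₀
    choose c hc hcw using hw
    have hwc : ∀ n, rootCoeffs (w n) = mixedCoeffs l (pairCoeffs m (c n)) := fun n => by
      rw [hcw, mixedCoeffs_unmix hl.ne']
    have hsum : Filter.Tendsto (fun n => ∑ j, (w n j).re) Filter.atTop
        (nhds (∑ j, (z₀ j).re)) :=
      ((by fun_prop : Continuous fun z : Fin m → ℂ => ∑ j, (z j).re).tendsto z₀).comp hlim
    obtain ⟨M, hM⟩ := hsum.bddAbove_range
    have hbox : ∀ n, c n ∈ Set.Icc (0 : (Fin m → ℝ) × (Fin m → ℝ)) (fun _ => M, fun _ => M) := by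
      intro n
      have h1 := sum_re_roots (hwc n)
      have h2 : ∑ j, (w n j).re ≤ M := hM ⟨n, rfl⟩
      have p1 : 0 ≤ ∑ j, (c n).1 j := Finset.sum_nonneg fun j _ => ((hc n).1 j).le
      have p2 : 0 ≤ ∑ j, (c n).2 j := Finset.sum_nonneg fun j _ => ((hc n).2 j).le
      refine ⟨⟨fun j => ((hc n).1 j).le, fun j => ((hc n).2 j).le⟩, fun j => ?_, fun j => ?_⟩
      · have := Finset.single_le_sum (f := (c n).1) (fun i _ => ((hc n).1 i).le)
          (Finset.mem_univ j)
        show (c n).1 j ≤ M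
        linarith
      · have := Finset.single_le_sum (f := (c n).2) (fun i _ => ((hc n).2 i).le)
          (Finset.mem_univ j)
        show (c n).2 j ≤ M
        linarith
    obtain ⟨c₀, hc₀, φ, hφ, hφlim⟩ := isCompact_Icc.tendsto_subseq hbox
    have hz₀c : rootCoeffs z₀ = mixedCoeffs l (pairCoeffs m c₀) := by
      have t1 := ((continuous_rootCoeffs.tendsto z₀).comp hlim).comp hφ.tendsto_atTop
      have t2 := (((continuous_mixedCoeffs l).comp (continuous_pairCoeffs m)).tendsto c₀).comp hφlim
      refine tendsto_nhds_unique (t1.congr fun n => ?_) t2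
      exact hwc (φ n)
    have hpos := mem_posSet_of_mem_region hc₀.1.1 hc₀.1.2 hr (rootPoly_eq_polyF_iff.2 hz₀c)
    refine ⟨c₀, hpos, ?_⟩
    simp only [hz₀c]
    rw [unmix_mixedCoeffs hl.ne']

/-! ### Change of variables from the bidiagonal entries to the pair of polynomials -/

theorem lintegral_comp_sub_smul {k : ℕ} {t : ℝ} (ht : 0 < t) (w : Fin k → ℝ)
    {H : (Fin k → ℝ) → ENNReal} (hH : Measurable H) :
    ENNReal.ofReal (t ^ k) * ∫⁻ v, H (w - t • v) = ∫⁻ v, H v := by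
  have h1 : ∫⁻ v, H (w - t • v) = ∫⁻ u, H (w - u) ∂(Measure.map (fun v => t • v) volume) := by
    rw [lintegral_map (by fun_prop) (by fun_prop)]
  rw [h1, Measure.map_addHaar_smul _ ht.ne', lintegral_smul_measure, smul_eq_mul, ← mul_assoc,
    ← ENNReal.ofReal_mul (by positivity), lintegral_sub_left_eq_self]
  simp only [Module.finrank_fintype_fun_eq_card, Fintype.card_fin]
  rw [abs_of_pos (by positivity), mul_inv_cancel₀ (by positivity), ENNReal.ofReal_one, one_mul]

theorem lintegral_pi_snoc {k : ℕ} {H : (Fin (k + 1) → ℝ) → ENNReal} (hH : Measurable H) :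
    ∫⁻ u, H u = ∫⁻ a : ℝ, ∫⁻ b : Fin k → ℝ, H (Fin.snoc b a) := by
  have h := (volume_preserving_piFinSuccAbove (fun _ : Fin (k + 1) => ℝ) (Fin.last k)).symm
  rw [← h.lintegral_comp_emb (MeasurableEquiv.measurableEmbedding _), Measure.volume_eq_prod,
    lintegral_prod _ (by fun_prop)]
  refine lintegral_congr fun a => lintegral_congr fun b => ?_
  congr 1
  exact Fin.insertNth_last (α := fun _ => ℝ) a b

theorem lintegral_pi_cons {k : ℕ} {H : (Fin (k + 1) → ℝ) → ENNReal} (hH : Measurable H) :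
    ∫⁻ u, H u = ∫⁻ a : ℝ, ∫⁻ b : Fin k → ℝ, H (Fin.cons a b) := by
  have h := (volume_preserving_piFinSuccAbove (fun _ : Fin (k + 1) => ℝ) 0).symm
  rw [← h.lintegral_comp_emb (MeasurableEquiv.measurableEmbedding _), Measure.volume_eq_prod,
    lintegral_prod _ (by fun_prop)]
  refine lintegral_congr fun a => lintegral_congr fun b => ?_
  congr 1
  exact Fin.insertNth_zero (α := fun _ => ℝ) a b

theorem measurable_finSnoc {m : ℕ} : Measurable fun v : (Fin m → ℝ) × ℝ =>
    (Fin.snoc v.1 v.2 : Fin (m + 1) → ℝ) :=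
  (continuous_fst.finSnoc continuous_snd).measurable

theorem lintegral_sub_smul_snoc {k : ℕ} (w : Fin (k + 1) → ℝ)
    {H : (Fin (k + 1) → ℝ) → ENNReal} (hH : Measurable H) :
    ∫⁻ t in Set.Ioi (0 : ℝ), ∫⁻ v : Fin k → ℝ,
      ENNReal.ofReal (t ^ k) * H (w - t • (Fin.snoc v 1 : Fin (k + 1) → ℝ)) =
    ∫⁻ u in {u : Fin (k + 1) → ℝ | u (Fin.last k) < w (Fin.last k)}, H u := by
  have hsn : Measurable fun v : ℝ × (Fin k → ℝ) => (Fin.snoc v.2 v.1 : Fin (k + 1) → ℝ) :=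
    measurable_finSnoc.comp measurable_swap
  have hset : MeasurableSet {u : Fin (k + 1) → ℝ | u (Fin.last k) < w (Fin.last k)} :=
    measurableSet_lt (by fun_prop) measurable_const
  let G : ℝ → ENNReal := fun a => ∫⁻ b : Fin k → ℝ, H (Fin.snoc b a)
  have hG : Measurable G := Measurable.lintegral_prod_right (hH.comp hsn)
  have h1 : ∀ t ∈ Set.Ioi (0 : ℝ), ∫⁻ v : Fin k → ℝ,
      ENNReal.ofReal (t ^ k) * H (w - t • (Fin.snoc v 1 : Fin (k + 1) → ℝ)) =
      G (w (Fin.last k) - t) := by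
    intro t ht
    have e : ∀ v : Fin k → ℝ, w - t • (Fin.snoc v 1 : Fin (k + 1) → ℝ) =
        Fin.snoc ((fun j => w j.castSucc) - t • v) (w (Fin.last k) - t) := fun v => by
      funext j
      refine Fin.lastCases ?_ (fun j => ?_) j <;> simp
    simp_rw [e]
    have hm : Measurable fun b : Fin k → ℝ =>
        H (Fin.snoc b (w (Fin.last k) - t) : Fin (k + 1) → ℝ) :=
      hH.comp (measurable_finSnoc.comp (measurable_id.prodMk measurable_const))
    have hm' : Measurable fun v : Fin k → ℝ =>
        H (Fin.snoc ((fun j => w j.castSucc) - t • v) (w (Fin.last k) - t) : Fin (k + 1) → ℝ) :=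
      hm.comp (by fun_prop : Measurable fun v : Fin k → ℝ => (fun j => w j.castSucc) - t • v)
    rw [lintegral_const_mul _ hm']
    exact lintegral_comp_sub_smul ht _ hm
  rw [setLIntegral_congr_fun measurableSet_Ioi h1, ← lintegral_indicator hset,
    lintegral_pi_snoc (hH.indicator hset), ← lintegral_indicator measurableSet_Ioi,
    ← lintegral_sub_left_eq_self _ (w (Fin.last k))]
  refine lintegral_congr fun a => ?_
  by_cases h : a < w (Fin.last k)
  · rw [Set.indicator_of_mem (by simpa using h)]
    simp only [sub_sub_cancel, G]
    refine lintegral_congr fun b => ?_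
    rw [Set.indicator_of_mem]
    simpa using h
  · rw [Set.indicator_of_notMem (by simpa using h)]
    symm
    rw [← lintegral_zero (μ := (volume : Measure (Fin k → ℝ)))]
    refine lintegral_congr fun b => ?_
    rw [Set.indicator_of_notMem]
    simpa using h

theorem lintegral_pairStep {m : ℕ} {K : (Fin (m + 1) → ℝ) × (Fin (m + 1) → ℝ) → ENNReal}
    (hK : Measurable K) (hK0 : ∀ q ∉ pairSet (m + 1), K q = 0) :
    ∫⁻ x in Set.Ioi (0 : ℝ), ∫⁻ y in Set.Ioi (0 : ℝ), ∫⁻ q : (Fin m → ℝ) × (Fin m → ℝ),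
      ENNReal.ofReal (x ^ m) * (ENNReal.ofReal (y ^ m) * K (pairStep x y q)) = ∫⁻ q, K q := by
  have hcons : Measurable fun v : Fin m → ℝ => (Fin.cons 0 v : Fin (m + 1) → ℝ) :=
    measurable_finCons.comp (measurable_const.prodMk measurable_id)
  have hsnoc : Measurable fun v : Fin m → ℝ => (Fin.snoc v 1 : Fin (m + 1) → ℝ) :=
    measurable_finSnoc.comp (measurable_id.prodMk measurable_const)
  have hstep : Measurable fun r : ℝ × ℝ × (Fin m → ℝ) × (Fin m → ℝ) =>
      pairStep r.1 r.2.1 r.2.2 := by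
    unfold pairStep
    have a1 := hcons.comp (f := fun r : ℝ × ℝ × (Fin m → ℝ) × (Fin m → ℝ) => r.2.2.1) (by fun_prop)
    have a2 := hsnoc.comp (f := fun r : ℝ × ℝ × (Fin m → ℝ) × (Fin m → ℝ) => r.2.2.2) (by fun_prop)
    have a3 := hsnoc.comp (f := fun r : ℝ × ℝ × (Fin m → ℝ) × (Fin m → ℝ) => r.2.2.1) (by fun_prop)
    have b := a1.sub ((measurable_snd.fst).smul a2)
    exact (b.sub (measurable_fst.smul a3)).prodMk b
  have inner : ∀ x ∈ Set.Ioi (0 : ℝ),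
      ∫⁻ y in Set.Ioi (0 : ℝ), ∫⁻ q : (Fin m → ℝ) × (Fin m → ℝ),
        ENNReal.ofReal (x ^ m) * (ENNReal.ofReal (y ^ m) * K (pairStep x y q)) =
      ∫⁻ a : Fin m → ℝ, ∫⁻ s : Fin (m + 1) → ℝ,
        ENNReal.ofReal (x ^ m) * K (s - x • (Fin.snoc a 1 : Fin (m + 1) → ℝ), s) := by
    intro x hx
    have hKx : Measurable fun r : ℝ × (Fin m → ℝ) × (Fin m → ℝ) =>
        ENNReal.ofReal (x ^ m) * (ENNReal.ofReal (r.1 ^ m) * K (pairStep x r.1 r.2)) := by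
      refine Measurable.const_mul (Measurable.mul (by fun_prop) (hK.comp ?_)) _
      exact hstep.comp (f := fun r : ℝ × (Fin m → ℝ) × (Fin m → ℝ) => (x, r.1, r.2)) (by fun_prop)
    have e1 : ∀ y : ℝ, ∫⁻ q : (Fin m → ℝ) × (Fin m → ℝ),
        ENNReal.ofReal (x ^ m) * (ENNReal.ofReal (y ^ m) * K (pairStep x y q)) =
        ∫⁻ a : Fin m → ℝ, ∫⁻ b : Fin m → ℝ,
          ENNReal.ofReal (x ^ m) * (ENNReal.ofReal (y ^ m) * K (pairStep x y (a, b))) := fun y => by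
      rw [Measure.volume_eq_prod, lintegral_prod]
      exact (hKx.comp (f := fun q : (Fin m → ℝ) × (Fin m → ℝ) => (y, q)) (by fun_prop)).aemeasurable
    simp_rw [e1]
    rw [lintegral_lintegral_swap]
    · refine lintegral_congr fun a => ?_
      have hKa : Measurable fun s : Fin (m + 1) → ℝ =>
          K (s - x • (Fin.snoc a 1 : Fin (m + 1) → ℝ), s) := hK.comp (by fun_prop)
      have e2 := lintegral_sub_smul_snoc (Fin.cons 0 a : Fin (m + 1) → ℝ)
        (hKa.const_mul (ENNReal.ofReal (x ^ m)))
      have e3 : ∀ y : ℝ, ∀ b : Fin m → ℝ,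
          ENNReal.ofReal (x ^ m) * (ENNReal.ofReal (y ^ m) * K (pairStep x y (a, b))) =
          ENNReal.ofReal (y ^ m) * (ENNReal.ofReal (x ^ m) *
            K ((Fin.cons 0 a : Fin (m + 1) → ℝ) - y • (Fin.snoc b 1 : Fin (m + 1) → ℝ) -
              x • (Fin.snoc a 1 : Fin (m + 1) → ℝ),
              (Fin.cons 0 a : Fin (m + 1) → ℝ) - y • (Fin.snoc b 1 : Fin (m + 1) → ℝ))) :=
        fun y b => mul_left_comm _ _ _
      simp_rw [e3]
      rw [e2]
      refine setLIntegral_eq_of_support_subset ?_ |>.trans rfl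
      intro s hs
      by_contra hn
      refine hs ?_
      simp only
      rw [hK0, mul_zero]
      intro hmem
      obtain ⟨-, h2, -⟩ := mem_pairSet_succ.1 hmem
      have hX : headX (s - x • (Fin.snoc a 1 : Fin (m + 1) → ℝ), s) = x := by simp [headX]
      have hP : lowerP (s - x • (Fin.snoc a 1 : Fin (m + 1) → ℝ), s) = a := by
        funext k
        rw [lowerP, hX]
        simp [(ne_of_gt hx : x ≠ 0)]
      rw [headY, hP] at h2
      exact hn (sub_pos.1 h2)
    · exact (Measurable.lintegral_prod_right' (f := fun r : (ℝ × (Fin m → ℝ)) × (Fin m → ℝ) =>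
        ENNReal.ofReal (x ^ m) * (ENNReal.ofReal (r.1.1 ^ m) * K (pairStep x r.1.1 (r.1.2, r.2))))
        (hKx.comp (f := fun r : (ℝ × (Fin m → ℝ)) × (Fin m → ℝ) => (r.1.1, r.1.2, r.2))
          (by fun_prop))).aemeasurable
  rw [setLIntegral_congr_fun measurableSet_Ioi inner]
  have hKs : Measurable fun r : ℝ × (Fin m → ℝ) × (Fin (m + 1) → ℝ) =>
      ENNReal.ofReal (r.1 ^ m) * K (r.2.2 - r.1 • (Fin.snoc r.2.1 1 : Fin (m + 1) → ℝ), r.2.2) := by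
    refine Measurable.mul (by fun_prop) (hK.comp ?_)
    have a3 := hsnoc.comp (f := fun r : ℝ × (Fin m → ℝ) × (Fin (m + 1) → ℝ) => r.2.1) (by fun_prop)
    exact ((measurable_snd.snd).sub (measurable_fst.smul a3)).prodMk measurable_snd.snd
  have swap1 : ∀ x : ℝ, ∫⁻ a : Fin m → ℝ, ∫⁻ s : Fin (m + 1) → ℝ,
        ENNReal.ofReal (x ^ m) * K (s - x • (Fin.snoc a 1 : Fin (m + 1) → ℝ), s) =
      ∫⁻ s : Fin (m + 1) → ℝ, ∫⁻ a : Fin m → ℝ,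
        ENNReal.ofReal (x ^ m) * K (s - x • (Fin.snoc a 1 : Fin (m + 1) → ℝ), s) := fun x =>
    lintegral_lintegral_swap (hKs.comp
      (f := fun r : (Fin m → ℝ) × (Fin (m + 1) → ℝ) => (x, r.1, r.2)) (by fun_prop)).aemeasurable
  simp_rw [swap1]
  rw [lintegral_lintegral_swap]
  · rw [Measure.volume_eq_prod, lintegral_prod_symm _ hK.aemeasurable]
    refine lintegral_congr fun s => ?_
    rw [lintegral_sub_smul_snoc s (H := fun p => K (p, s)) (hK.comp (by fun_prop))]
    refine setLIntegral_eq_of_support_subset ?_ |>.trans rfl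
    intro p hp
    by_contra hn
    refine hp (hK0 _ fun hmem => hn ?_)
    exact sub_pos.1 (mem_pairSet_succ.1 hmem).1
  · exact (Measurable.lintegral_prod_right'
      (f := fun r : (ℝ × (Fin (m + 1) → ℝ)) × (Fin m → ℝ) => ENNReal.ofReal (r.1.1 ^ m) *
        K (r.1.2 - r.1.1 • (Fin.snoc r.2 1 : Fin (m + 1) → ℝ), r.1.2))
      (hKs.comp (f := fun r : (ℝ × (Fin (m + 1) → ℝ)) × (Fin m → ℝ) => (r.1.1, r.2, r.1.2))
        (by fun_prop))).aemeasurable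

/-- The reciprocal Jacobian weight of `pairCoeffs`. -/
def jacobianWeight {m : ℕ} (c : (Fin m → ℝ) × (Fin m → ℝ)) : ENNReal :=
  ∏ j : Fin m, (ENNReal.ofReal (c.1 j ^ (m - 1 - (j : ℕ))) *
    ENNReal.ofReal (c.2 j ^ (m - 1 - (j : ℕ))))

theorem measurable_jacobianWeight {m : ℕ} : Measurable (jacobianWeight (m := m)) := by
  unfold jacobianWeight
  exact Finset.measurable_prod _ fun j _ => by fun_prop

theorem jacobianWeight_cons {m : ℕ} (x y : ℝ) (a b : Fin m → ℝ) :
    jacobianWeight ((Fin.cons x a : Fin (m + 1) → ℝ), (Fin.cons y b : Fin (m + 1) → ℝ)) =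
      ENNReal.ofReal (x ^ m) * ENNReal.ofReal (y ^ m) * jacobianWeight (a, b) := by
  rw [jacobianWeight, Fin.prod_univ_succ]
  congr 1
  refine Finset.prod_congr rfl fun j _ => ?_
  have h2 : m + 1 - 1 - ((j.succ : Fin (m + 1)) : ℕ) = m - 1 - j := by simp; omega
  rw [h2]
  simp

theorem measurableSet_posSet (m : ℕ) : MeasurableSet (posSet m) := by
  have : posSet m = ⋂ j : Fin m, ({c | 0 < c.1 j} ∩ {c | 0 < c.2 j}) := by
    ext c
    simp [posSet, forall_and]
  rw [this]
  exact MeasurableSet.iInter fun j => (measurableSet_lt measurable_const (by fun_prop)).inter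
    (measurableSet_lt measurable_const (by fun_prop))

theorem cons_mem_posSet {m : ℕ} {x y : ℝ} {a b : Fin m → ℝ} :
    ((Fin.cons x a : Fin (m + 1) → ℝ), (Fin.cons y b : Fin (m + 1) → ℝ)) ∈ posSet (m + 1) ↔
      0 < x ∧ 0 < y ∧ (a, b) ∈ posSet m := by
  simp only [posSet, Set.mem_ofPred_eq, Fin.forall_fin_succ, Fin.cons_zero, Fin.cons_succ]
  tauto

theorem lintegral_pi_prod_pi_cons {m : ℕ}
    {G : (Fin (m + 1) → ℝ) × (Fin (m + 1) → ℝ) → ENNReal} (hG : Measurable G) :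
    ∫⁻ c, G c = ∫⁻ x : ℝ, ∫⁻ y : ℝ, ∫⁻ q : (Fin m → ℝ) × (Fin m → ℝ),
      G (Fin.cons x q.1, Fin.cons y q.2) := by
  have hm : Measurable fun r : ℝ × ℝ × (Fin m → ℝ) × (Fin m → ℝ) =>
      G (Fin.cons r.1 r.2.2.1, Fin.cons r.2.1 r.2.2.2) :=
    hG.comp ((measurable_finCons.comp (f := fun r : ℝ × ℝ × (Fin m → ℝ) × (Fin m → ℝ) =>
      (r.1, r.2.2.1)) (by fun_prop)).prodMk (measurable_finCons.comp
      (f := fun r : ℝ × ℝ × (Fin m → ℝ) × (Fin m → ℝ) => (r.2.1, r.2.2.2)) (by fun_prop)))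
  rw [Measure.volume_eq_prod, lintegral_prod _ hG.aemeasurable,
    lintegral_pi_cons hG.lintegral_prod_right']
  refine lintegral_congr fun x => ?_
  have h1 : ∀ a : Fin m → ℝ, ∫⁻ v : Fin (m + 1) → ℝ, G (Fin.cons x a, v) =
      ∫⁻ y : ℝ, ∫⁻ b : Fin m → ℝ, G (Fin.cons x a, Fin.cons y b) := fun a =>
    lintegral_pi_cons (hG.comp (by fun_prop))
  simp_rw [h1]
  rw [lintegral_lintegral_swap]
  · refine lintegral_congr fun y => ?_
    rw [Measure.volume_eq_prod, lintegral_prod]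
    exact (hm.comp (f := fun q : (Fin m → ℝ) × (Fin m → ℝ) => (x, y, q))
      (by fun_prop)).aemeasurable
  · exact (Measurable.lintegral_prod_right' (f := fun r : ((Fin m → ℝ) × ℝ) × (Fin m → ℝ) =>
      G (Fin.cons x r.1.1, Fin.cons r.1.2 r.2)) (hm.comp
        (f := fun r : ((Fin m → ℝ) × ℝ) × (Fin m → ℝ) => (x, r.1.2, r.1.1, r.2))
        (by fun_prop))).aemeasurable

theorem lintegral_pairCoeffs : ∀ (m : ℕ) {H : (Fin m → ℝ) × (Fin m → ℝ) → ENNReal},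
    Measurable H →
    ∫⁻ c in posSet m, jacobianWeight c * H (pairCoeffs m c) = ∫⁻ q in pairSet m, H q
  | 0, H, _ => by
    have h1 : posSet 0 = Set.univ := Set.eq_univ_of_forall fun q => by simp [posSet]
    have h2 : pairSet 0 = Set.univ := Set.eq_univ_of_forall fun q => ⟨q, by simp [posSet], rfl⟩
    rw [h1, h2]
    simp [jacobianWeight, pairCoeffs]
  | m + 1, H, hH => by
    have hU := (isOpen_pairSet (m + 1)).measurableSet
    have hP := measurableSet_posSet (m + 1)
    have hK : Measurable ((pairSet (m + 1)).indicator H) := hH.indicator hU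
    have hpc := (continuous_pairCoeffs (m + 1)).measurable
    have hG : Measurable fun c => jacobianWeight c * H (pairCoeffs (m + 1) c) :=
      measurable_jacobianWeight.mul (hH.comp hpc)
    rw [← lintegral_indicator hP, ← lintegral_indicator hU,
      ← lintegral_pairStep hK fun q hq => Set.indicator_of_notMem hq _,
      lintegral_pi_prod_pi_cons (hG.indicator hP),
      ← lintegral_indicator measurableSet_Ioi]
    refine lintegral_congr fun x => ?_
    by_cases hx : 0 < x
    swap
    · rw [Set.indicator_of_notMem (show x ∉ Set.Ioi (0 : ℝ) from hx)]
      simp [Set.indicator_of_notMem, cons_mem_posSet, hx]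
    rw [Set.indicator_of_mem (show x ∈ Set.Ioi (0 : ℝ) from hx),
      ← lintegral_indicator measurableSet_Ioi]
    refine lintegral_congr fun y => ?_
    by_cases hy : 0 < y
    swap
    · rw [Set.indicator_of_notMem (show y ∉ Set.Ioi (0 : ℝ) from hy)]
      simp [Set.indicator_of_notMem, cons_mem_posSet, hy]
    rw [Set.indicator_of_mem (show y ∈ Set.Ioi (0 : ℝ) from hy)]
    have hstep : Measurable fun q : (Fin m → ℝ) × (Fin m → ℝ) => pairStep x y q := by
      unfold pairStep
      have a1 := measurable_finCons.comp
        (f := fun q : (Fin m → ℝ) × (Fin m → ℝ) => ((0 : ℝ), q.1)) (by fun_prop)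
      have a2 := measurable_finSnoc.comp
        (f := fun q : (Fin m → ℝ) × (Fin m → ℝ) => (q.2, (1 : ℝ))) (by fun_prop)
      have a3 := measurable_finSnoc.comp
        (f := fun q : (Fin m → ℝ) × (Fin m → ℝ) => (q.1, (1 : ℝ))) (by fun_prop)
      have b := a1.sub (a2.const_smul y)
      exact (b.sub (a3.const_smul x)).prodMk b
    have ih := lintegral_pairCoeffs m (H := fun q =>
      ENNReal.ofReal (x ^ m) * (ENNReal.ofReal (y ^ m) * H (pairStep x y q)))
      (((hH.comp hstep).const_mul _).const_mul _)
    rw [← lintegral_indicator (measurableSet_posSet m),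
      ← lintegral_indicator (isOpen_pairSet m).measurableSet] at ih
    convert ih using 1
    · refine lintegral_congr fun q => ?_
      by_cases hq : q ∈ posSet m
      · rw [Set.indicator_of_mem hq, Set.indicator_of_mem (cons_mem_posSet.2 ⟨hx, hy, hq⟩),
          jacobianWeight_cons, pairCoeffs_succ]
        simp only [tailPair, Fin.tail_cons, Fin.cons_zero, Prod.mk.eta]
        ring
      · rw [Set.indicator_of_notMem hq, Set.indicator_of_notMem]
        exact fun h => hq (cons_mem_posSet.1 h).2.2
    · refine lintegral_congr fun q => ?_
      by_cases hq : q ∈ pairSet m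
      · rw [Set.indicator_of_mem hq, Set.indicator_of_mem ((pairStep_mem_pairSet hx hy q).2 hq)]
      · rw [Set.indicator_of_notMem hq, Set.indicator_of_notMem
          (fun h => hq ((pairStep_mem_pairSet hx hy q).1 h)), mul_zero, mul_zero]

/-! ### Product densities -/

theorem lintegral_pi_finset_prod : ∀ {m : ℕ} (μ : Fin m → Measure ℝ) [∀ j, SigmaFinite (μ j)]
    {f : Fin m → ℝ → ENNReal}, (∀ j, Measurable (f j)) →
    ∫⁻ v, ∏ j, f j (v j) ∂(Measure.pi μ) = ∏ j, ∫⁻ x, f j x ∂(μ j)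
  | 0, μ, _, f, _ => by simp
  | m + 1, μ, _, f, hf => by
    have h := (measurePreserving_piFinSuccAbove μ 0).symm
    have hm : Measurable fun v : Fin m → ℝ => ∏ j : Fin m, f j.succ (v j) :=
      Finset.measurable_prod _ fun j _ => (hf _).comp (by fun_prop)
    rw [← h.lintegral_comp_emb (MeasurableEquiv.measurableEmbedding _), Fin.prod_univ_succ]
    have ih := lintegral_pi_finset_prod (fun j => μ (Fin.succ j)) fun j => hf (Fin.succ j)
    rw [← ih]
    have h2 := lintegral_prod_mul (μ := μ 0) (ν := Measure.pi fun j => μ (Fin.succ j))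
      (hf 0).aemeasurable hm.aemeasurable
    rw [← h2]
    refine lintegral_congr fun r => ?_
    rw [Fin.prod_univ_succ]
    rfl

theorem pi_withDensity {m : ℕ} (μ : Fin m → Measure ℝ) [∀ j, SigmaFinite (μ j)]
    {f : Fin m → ℝ → ENNReal} (hf : ∀ j, Measurable (f j))
    [∀ j, SigmaFinite ((μ j).withDensity (f j))] :
    Measure.pi (fun j => (μ j).withDensity (f j)) =
      (Measure.pi μ).withDensity fun v => ∏ j, f j (v j) := by
  refine Measure.pi_eq fun s hs => ?_
  rw [withDensity_apply _ (MeasurableSet.univ_pi hs), Measure.restrict_pi_pi,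
    lintegral_pi_finset_prod _ hf]
  exact Finset.prod_congr rfl fun j _ => (withDensity_apply _ (hs j)).symm

/-- The density of the square of a `χ_k` variable. -/
def chiSqPdf (k x : ℝ) : ℝ :=
  x ^ (k / 2 - 1) * Real.exp (-x / 2) / ((2 : ℝ) ^ (k / 2) * Real.Gamma (k / 2))

theorem measurable_chiSqPdf (k : ℝ) : Measurable (chiSqPdf k) := by
  unfold chiSqPdf
  fun_prop

theorem chiSqPdf_nonneg {k x : ℝ} (hk : 0 < k) (hx : 0 ≤ x) : 0 ≤ chiSqPdf k x := by
  have := Real.Gamma_pos_of_pos (half_pos hk)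
  unfold chiSqPdf
  positivity

/-- The law of the square of a `χ_k` variable. -/
def chiSq (k : ℝ) : Measure ℝ :=
  (volume.restrict (Set.Ioi 0)).withDensity fun x => ENNReal.ofReal (chiSqPdf k x)

instance (k : ℝ) : SigmaFinite (chiSq k) := by
  unfold chiSq
  infer_instance

instance (k : ℝ) : SigmaFinite (chi k) := by
  unfold chi
  infer_instance

theorem measurable_chi_density (k : ℝ) : Measurable fun x : ℝ => ENNReal.ofReal
    (x ^ (k - 1) * Real.exp (-x ^ 2 / 2) / ((2 : ℝ) ^ (k / 2 - 1) * Real.Gamma (k / 2))) := by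
  fun_prop

theorem measurePreserving_sq_chi (k : ℝ) :
    MeasurePreserving (fun x : ℝ => x ^ 2) (chi k) (chiSq k) := by
  refine ⟨by fun_prop, Measure.ext_of_lintegral _ fun H hH => ?_⟩
  rw [lintegral_map hH (by fun_prop), chi, chiSq,
    lintegral_withDensity_eq_lintegral_mul _ (measurable_chi_density k) (by fun_prop),
    lintegral_withDensity_eq_lintegral_mul _ (measurable_chiSqPdf k).ennreal_ofReal hH]
  have himage : (fun x : ℝ => x ^ 2) '' Set.Ioi 0 = Set.Ioi 0 := by
    ext y
    constructor
    · rintro ⟨x, hx, rfl⟩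
      exact pow_pos (Set.mem_Ioi.1 hx) 2
    · intro hy
      exact ⟨√y, Real.sqrt_pos.2 hy, Real.sq_sqrt (le_of_lt hy)⟩
  have hinj : Set.InjOn (fun x : ℝ => x ^ 2) (Set.Ioi 0) := fun x hx y hy h =>
    (pow_left_inj₀ (le_of_lt hx) (le_of_lt hy) two_ne_zero).1 h
  have h := lintegral_image_eq_lintegral_abs_deriv_mul measurableSet_Ioi
    (fun x _ => (hasDerivAt_pow 2 x).hasDerivWithinAt) hinj
    ((fun x => ENNReal.ofReal (chiSqPdf k x)) * H)
  rw [himage] at h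
  rw [h]
  refine setLIntegral_congr_fun measurableSet_Ioi fun x hx => ?_
  have hx' : 0 < x := hx
  simp only [Pi.mul_apply, ← mul_assoc]
  rw [← ENNReal.ofReal_mul (abs_nonneg _)]
  congr 2
  have e1 : x ^ (k - 1) = x * (x ^ 2) ^ (k / 2 - 1) := by
    rw [← Real.rpow_natCast x 2, ← Real.rpow_mul hx'.le]
    conv_rhs => rw [← Real.rpow_one x, ← Real.rpow_mul hx'.le, ← Real.rpow_add hx']
    congr 1
    push_cast
    ring
  have e2 : (2 : ℝ) ^ (k / 2) = 2 * 2 ^ (k / 2 - 1) := by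
    rw [Real.rpow_sub two_pos, Real.rpow_one]
    ring
  have e3 : |((2 : ℕ) : ℝ) * x ^ (2 - 1)| = 2 * x := by
    rw [abs_of_nonneg (by positivity)]
    norm_num
  rw [chiSqPdf, e1, e2, e3]
  field_simp

/-- The joint density of the squares of the bidiagonal entries. -/
def squarePdf (β : ℝ) (m n : ℕ) (c : (Fin m → ℝ) × (Fin m → ℝ)) : ENNReal :=
  (∏ j : Fin m, ENNReal.ofReal (chiSqPdf (β * ((m : ℝ) - ((j : ℕ) + 1) + 1)) (c.1 j))) *
    ∏ j : Fin m, ENNReal.ofReal (chiSqPdf (β * ((n : ℝ) - ((j : ℕ) + 1))) (c.2 j))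

theorem measurable_squarePdf (β : ℝ) (m n : ℕ) : Measurable (squarePdf β m n) := by
  unfold squarePdf
  refine Measurable.mul ?_ ?_ <;>
  exact Finset.measurable_prod _ fun j _ =>
    ((measurable_chiSqPdf _).comp (by fun_prop)).ennreal_ofReal

/-- The squares of the bidiagonal entries. -/
def squares {m : ℕ} (c : (Fin m → ℝ) × (Fin m → ℝ)) : (Fin m → ℝ) × (Fin m → ℝ) :=
  (fun j => c.1 j ^ 2, fun j => c.2 j ^ 2)

theorem measurePreserving_squares (β : ℝ) (m n : ℕ) :
    MeasurePreserving squares (coefficientLaw β m n)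
      ((volume.restrict (posSet m)).withDensity (squarePdf β m n)) := by
  have h1 := measurePreserving_pi (fun j : Fin m => chi (β * ((m : ℝ) - ((j : ℕ) + 1) + 1)))
    (fun j : Fin m => chiSq (β * ((m : ℝ) - ((j : ℕ) + 1) + 1)))
    fun j => measurePreserving_sq_chi _
  have h2 := measurePreserving_pi (fun j : Fin m => chi (β * ((n : ℝ) - ((j : ℕ) + 1))))
    (fun j : Fin m => chiSq (β * ((n : ℝ) - ((j : ℕ) + 1))))
    fun j => measurePreserving_sq_chi _
  have h3 := h1.prod h2
  have hpi : ∀ k : Fin m → ℝ, Measure.pi (fun j => chiSq (k j)) =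
      (volume.restrict (Set.univ.pi fun _ => Set.Ioi 0)).withDensity
        fun v : Fin m → ℝ => ∏ j, ENNReal.ofReal (chiSqPdf (k j) (v j)) := fun k => by
    unfold chiSq
    rw [pi_withDensity _ fun j => (measurable_chiSqPdf _).ennreal_ofReal, volume_pi,
      Measure.restrict_pi_pi]
  have hm : ∀ k : Fin m → ℝ, Measurable fun v : Fin m → ℝ =>
      ∏ j, ENNReal.ofReal (chiSqPdf (k j) (v j)) := fun k =>
    Finset.measurable_prod _ fun j _ => ((measurable_chiSqPdf _).comp (by fun_prop)).ennreal_ofReal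
  rw [hpi, hpi] at h3
  rw [prod_withDensity₀ (hm _).aemeasurable (hm _).aemeasurable, Measure.prod_restrict] at h3
  have hset : posSet m = (Set.univ.pi fun _ => Set.Ioi 0) ×ˢ (Set.univ.pi fun _ => Set.Ioi 0) := by
    ext c
    simp [posSet]
  rw [hset]
  exact h3

/-- The density of the pair `(p, s)`, as a function of the entries. -/
def pairPdf (β : ℝ) (m n : ℕ) (c : (Fin m → ℝ) × (Fin m → ℝ)) : ℝ :=
  ∏ j : Fin m, (chiSqPdf (β * ((m : ℝ) - ((j : ℕ) + 1) + 1)) (c.1 j) *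
    chiSqPdf (β * ((n : ℝ) - ((j : ℕ) + 1))) (c.2 j) /
      (c.1 j ^ (m - 1 - (j : ℕ)) * c.2 j ^ (m - 1 - (j : ℕ))))

theorem measurable_pairPdf (β : ℝ) (m n : ℕ) : Measurable (pairPdf β m n) := by
  unfold pairPdf
  refine Finset.measurable_prod _ fun j _ => Measurable.div (Measurable.mul ?_ ?_) (by fun_prop)
  · exact (measurable_chiSqPdf _).comp (by fun_prop)
  · exact (measurable_chiSqPdf _).comp (by fun_prop)

theorem squarePdf_eq {β : ℝ} (hβ : 0 < β) {m n : ℕ} (hmn : m + 1 ≤ n)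
    {c : (Fin m → ℝ) × (Fin m → ℝ)} (hc : c ∈ posSet m) :
    squarePdf β m n c = jacobianWeight c * ENNReal.ofReal (pairPdf β m n c) := by
  have hk1 : ∀ j : Fin m, 0 < β * ((m : ℝ) - ((j : ℕ) + 1) + 1) := fun j => by
    have : ((j : ℕ) : ℝ) < m := by exact_mod_cast j.2
    exact mul_pos hβ (by linarith)
  have hk2 : ∀ j : Fin m, 0 < β * ((n : ℝ) - ((j : ℕ) + 1)) := fun j => by
    have : ((j : ℕ) : ℝ) < m := by exact_mod_cast j.2
    have : (m : ℝ) + 1 ≤ n := by exact_mod_cast hmn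
    exact mul_pos hβ (by linarith)
  have h1 := fun j => chiSqPdf_nonneg (hk1 j) (hc.1 j).le
  have h2 := fun j => chiSqPdf_nonneg (hk2 j) (hc.2 j).le
  have p1 := hc.1
  have p2 := hc.2
  rw [squarePdf, jacobianWeight, pairPdf, ENNReal.ofReal_prod_of_nonneg,
    ← Finset.prod_mul_distrib, ← Finset.prod_mul_distrib]
  · refine Finset.prod_congr rfl fun j _ => ?_
    have q1 : 0 < c.1 j ^ (m - 1 - (j : ℕ)) := pow_pos (p1 j) _
    have q2 : 0 < c.2 j ^ (m - 1 - (j : ℕ)) := pow_pos (p2 j) _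
    rw [← ENNReal.ofReal_mul (h1 j), ← ENNReal.ofReal_mul q1.le,
      ← ENNReal.ofReal_mul (mul_pos q1 q2).le, mul_div_cancel₀ _ (mul_pos q1 q2).ne']
  · intro j _
    exact div_nonneg (mul_nonneg (h1 j) (h2 j))
      (mul_pos (pow_pos (p1 j) _) (pow_pos (p2 j) _)).le

theorem lintegral_coefficientLaw {β : ℝ} (hβ : 0 < β) {m n : ℕ} (hmn : m + 1 ≤ n)
    {H : (Fin m → ℝ) × (Fin m → ℝ) → ENNReal} (hH : Measurable H) :
    ∫⁻ c, H (pairCoeffs m (squares c)) ∂(coefficientLaw β m n) =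
      ∫⁻ q in pairSet m, ENNReal.ofReal (pairPdf β m n (paramOf m q)) * H q := by
  have hpc := (continuous_pairCoeffs m).measurable
  have hW := (measurable_pairPdf β m n).comp (measurable_paramOf m)
  have hHF : Measurable fun c => H (pairCoeffs m c) := hH.comp hpc
  rw [(measurePreserving_squares β m n).lintegral_comp hHF,
    lintegral_withDensity_eq_lintegral_mul _ (measurable_squarePdf β m n) hHF]
  refine Eq.trans ?_ (lintegral_pairCoeffs m (hW.ennreal_ofReal.mul hH))
  refine setLIntegral_congr_fun (measurableSet_posSet m) fun c hc => ?_
  simp only [Pi.mul_apply]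
  rw [squarePdf_eq hβ hmn hc, paramOf_pairCoeffs hc, mul_assoc]

theorem lintegral_unmix {m : ℕ} {l : ℝ} (hl : 0 < l)
    {G : (Fin m → ℝ) × (Fin m → ℝ) → ENNReal} (hG : Measurable G) :
    ∫⁻ v : Fin m → ℂ, G (unmix l v) = ENNReal.ofReal (l ^ m) * ∫⁻ q, G q := by
  have hp : MeasurePreserving (fun v : Fin m → ℂ =>
      ((fun k => (v k).re, fun k => (v k).im) : (Fin m → ℝ) × (Fin m → ℝ))) :=
    (volume_measurePreserving_arrowProdEquivProdArrow ℝ ℝ (Fin m)).comp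
      (volume_preserving_pi fun _ => Complex.volume_preserving_equiv_real_prod)
  have h1 := hp.lintegral_comp (f := fun r : (Fin m → ℝ) × (Fin m → ℝ) =>
    G (r.1, r.1 - l⁻¹ • r.2)) (hG.comp (by fun_prop))
  have h2 : ∀ v : Fin m → ℂ, G (unmix l v) =
      G ((fun k => (v k).re), (fun k => (v k).re) - l⁻¹ • fun k => (v k).im) := fun v => by
    congr 1
    refine Prod.ext rfl (funext fun k => ?_)
    simp [unmix, div_eq_inv_mul]
  simp_rw [h2]
  have hG' : Measurable fun r : (Fin m → ℝ) × (Fin m → ℝ) => G (r.1, r.1 - l⁻¹ • r.2) :=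
    hG.comp (by fun_prop)
  rw [h1, Measure.volume_eq_prod, lintegral_prod _ hG'.aemeasurable,
    lintegral_prod _ hG.aemeasurable, ← lintegral_const_mul _ hG.lintegral_prod_right']
  refine lintegral_congr fun a => ?_
  have hGa : Measurable fun s : Fin m → ℝ => G (a, s) := hG.comp (by fun_prop)
  rw [← lintegral_comp_sub_smul (inv_pos.2 hl) a hGa, ← mul_assoc,
    ← ENNReal.ofReal_mul (by positivity), inv_pow, mul_inv_cancel₀ (by positivity),
    ENNReal.ofReal_one, one_mul]

theorem det_of_first_row_column {R : Type*} [CommRing R] {n : ℕ}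
    (A : Matrix (Fin (n + 2)) (Fin (n + 2)) R) (h : ∀ j : Fin n, A 0 j.succ.succ = 0)
    (h' : ∀ i : Fin n, A i.succ.succ 0 = 0) :
    A.det = A 0 0 * (A.submatrix Fin.succ Fin.succ).det -
      A 0 1 * A 1 0 * ((A.submatrix Fin.succ Fin.succ).submatrix Fin.succ Fin.succ).det := by
  rw [Matrix.det_succ_row_zero, Fin.sum_univ_succ, Fin.sum_univ_succ]
  rw [Finset.sum_eq_zero fun j _ => by rw [h]; ring]
  have h1 : (A.submatrix Fin.succ (Fin.succAbove (Fin.succ 0))).det =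
      A 1 0 * ((A.submatrix Fin.succ Fin.succ).submatrix Fin.succ Fin.succ).det := by
    rw [Matrix.det_succ_column_zero, Fin.sum_univ_succ]
    rw [Finset.sum_eq_zero fun j _ => by
      rw [Matrix.submatrix_apply, Fin.succ_zero_eq_one, Fin.one_succAbove_zero, h']; ring]
    have e : (Fin.succAbove (Fin.succ (0 : Fin (n + 1)))) ∘ Fin.succ = Fin.succ ∘ Fin.succ := by
      funext j
      simp [Fin.one_succAbove_succ]
    simp only [Matrix.submatrix_submatrix, Fin.succAbove_zero, e]
    simp
  rw [h1]
  simp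
  ring

/-- The matrix `B diag(κ, 1, …, 1) Bᵀ` for the bidiagonal matrix `B`. -/
def weightedGram {m : ℕ} (κ : ℂ) (c : (Fin m → ℝ) × (Fin m → ℝ)) :
    Matrix (Fin (m + 1)) (Fin (m + 1)) ℂ :=
  Matrix.of fun i j => ∑ k, (bidiagonal c.1 c.2 i k : ℂ) *
    (Fin.cons κ (fun _ => 1) : Fin (m + 1) → ℂ) k * (bidiagonal c.1 c.2 j k : ℂ)

section bidiagonal
variable {m : ℕ} (x y : Fin (m + 1) → ℝ)

theorem bidiagonal_succ_succ (i k : Fin (m + 1)) :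
    bidiagonal x y i.succ k.succ = bidiagonal (Fin.tail x) (Fin.tail y) i k := by
  simp only [bidiagonal, Matrix.of_apply, Fin.val_succ, Nat.add_lt_add_iff_right,
    Nat.add_right_cancel_iff]
  rfl

theorem bidiagonal_succ_zero (i : Fin (m + 1)) : bidiagonal x y i.succ 0 = 0 := by
  simp [bidiagonal]

theorem bidiagonal_zero_zero : bidiagonal x y 0 0 = x 0 := by
  simp [bidiagonal]

theorem bidiagonal_zero_succ (k : Fin (m + 1)) :
    bidiagonal x y 0 k.succ = if k = 0 then y 0 else 0 := by
  by_cases hk : k = 0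
  · subst hk
    simp [bidiagonal]
  · have h : (k : ℕ) ≠ 0 := fun h => hk (Fin.ext h)
    simp [bidiagonal, hk, h]

end bidiagonal

section weightedGram
variable {m : ℕ} (κ : ℂ) (c : (Fin (m + 1) → ℝ) × (Fin (m + 1) → ℝ))

theorem weightedGram_zero_zero :
    weightedGram κ c 0 0 = κ * (c.1 0 : ℂ) ^ 2 + (c.2 0 : ℂ) ^ 2 := by
  rw [weightedGram, Matrix.of_apply, Fin.sum_univ_succ]
  simp only [bidiagonal_zero_zero, bidiagonal_zero_succ]
  rw [Finset.sum_eq_single 0 (fun k _ hk => by simp [hk]) (by simp)]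
  simp
  ring

theorem weightedGram_zero_succ (j : Fin (m + 1)) : weightedGram κ c 0 j.succ =
    c.2 0 * (bidiagonal (Fin.tail c.1) (Fin.tail c.2) j 0 : ℂ) := by
  rw [weightedGram, Matrix.of_apply, Fin.sum_univ_succ]
  simp only [bidiagonal_zero_succ, bidiagonal_succ_zero, bidiagonal_succ_succ]
  rw [Finset.sum_eq_single 0 (fun k _ hk => by simp [hk]) (by simp)]
  simp

theorem weightedGram_symm (i j : Fin (m + 1 + 1)) : weightedGram κ c i j = weightedGram κ c j i := by
  simp only [weightedGram, Matrix.of_apply]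
  exact Finset.sum_congr rfl fun k _ => by ring

theorem weightedGram_succ_succ (i j : Fin (m + 1)) :
    weightedGram κ c i.succ j.succ = weightedGram 1 (tailPair c) i j := by
  have h : ∀ k, (Fin.cons 1 (fun _ => 1) : Fin (m + 1) → ℂ) k = 1 := fun k => by
    refine Fin.cases ?_ (fun k => ?_) k <;> simp
  rw [weightedGram, Matrix.of_apply, Fin.sum_univ_succ, weightedGram]
  simp [bidiagonal_succ_zero, bidiagonal_succ_succ, h, tailPair]

theorem charmatrix_weightedGram_submatrix :
    (weightedGram κ c).charmatrix.submatrix Fin.succ Fin.succ =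
      (weightedGram 1 (tailPair c)).charmatrix := by
  ext1 i j
  simp [Matrix.charmatrix_apply, weightedGram_succ_succ, Matrix.diagonal_apply]

end weightedGram

theorem bidiagonal_succ_left_zero {m : ℕ} (x y : Fin m → ℝ) (j : Fin (m + 1)) (hj : j ≠ 0) :
    bidiagonal x y j 0 = 0 := by
  have : (0 : ℕ) ≠ j := fun h => hj (Fin.ext h.symm)
  simp [bidiagonal, this]

theorem squares_tailPair {m : ℕ} (c : (Fin (m + 1) → ℝ) × (Fin (m + 1) → ℝ)) :
    squares (tailPair c) = tailPair (squares c) := rfl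

theorem charpoly_weightedGram : ∀ {m : ℕ} (κ : ℂ) (c : (Fin m → ℝ) × (Fin m → ℝ)),
    (weightedGram κ c).charpoly = X * (polyP (squares c) -
      C (κ - 1) * (polyS (squares c) - polyP (squares c)))
  | 0, κ, c => by
    rw [Matrix.charpoly, Matrix.det_fin_one]
    simp [weightedGram, bidiagonal]
  | 1, κ, c => by
    have ih := charpoly_weightedGram 1 (tailPair c)
    have h01 : (weightedGram κ c).charmatrix 0 1 = 0 := by
      rw [Matrix.charmatrix_apply_ne _ _ _ (by simp), ← Fin.succ_zero_eq_one,
        weightedGram_zero_succ]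
      simp [bidiagonal]
    rw [Matrix.charpoly, det_of_first_row_column _ (fun j => j.elim0) (fun j => j.elim0), h01,
      charmatrix_weightedGram_submatrix, ← Matrix.charpoly, ih, Matrix.charmatrix_apply_eq,
      weightedGram_zero_zero, polyP_succ, polyS_succ]
    simp only [squares_tailPair, polyP_zero, polyS_zero, sub_self, C_0]
    simp [squares]
    ring
  | m + 2, κ, c => by
    have ih := charpoly_weightedGram 1 (tailPair c)
    have ih' := charpoly_weightedGram 1 (tailPair (tailPair c))
    have hz : ∀ j : Fin (m + 1), (weightedGram κ c) 0 j.succ.succ = 0 := fun j => by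
      rw [weightedGram_zero_succ, bidiagonal_succ_left_zero _ _ _ (Fin.succ_ne_zero j)]
      simp
    have h01 : (weightedGram κ c) 0 1 = c.2 0 * c.1 1 := by
      rw [← Fin.succ_zero_eq_one, weightedGram_zero_succ, bidiagonal_zero_zero]
      rfl
    rw [Matrix.charpoly, det_of_first_row_column, charmatrix_weightedGram_submatrix,
      charmatrix_weightedGram_submatrix, ← Matrix.charpoly, ← Matrix.charpoly, ih, ih',
      Matrix.charmatrix_apply_eq, Matrix.charmatrix_apply_ne _ _ _ (by simp),
      Matrix.charmatrix_apply_ne _ _ _ (by simp), weightedGram_symm κ c 1 0, h01,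
      weightedGram_zero_zero, polyP_succ (squares c), polyS_succ (squares c)]
    · simp only [squares_tailPair, polyP_succ (tailPair (squares c)), sub_self, C_0, zero_mul,
        sub_zero]
      simp [squares, tailPair, Fin.tail]
      ring
    · intro j
      rw [Matrix.charmatrix_apply_ne _ _ _ (Fin.succ_ne_zero _).symm, hz]
      simp
    · intro j
      rw [Matrix.charmatrix_apply_ne _ _ _ (Fin.succ_ne_zero _), weightedGram_symm, hz]
      simp

theorem charpoly_perturbed {m : ℕ} (l : ℝ) (c : (Fin m → ℝ) × (Fin m → ℝ)) :
    (perturbed l ((bidiagonal c.1 c.2).transpose * bidiagonal c.1 c.2)).charpoly =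
      X * polyF l (squares c) := by
  have h1 : (1 + (Complex.I * (l : ℂ)) • Matrix.vecMulVec (Pi.single 0 1 : Fin (m + 1) → ℂ)
      (star (Pi.single 0 1))) =
      Matrix.diagonal (Fin.cons (1 + Complex.I * l) (fun _ => 1) : Fin (m + 1) → ℂ) := by
    ext i j
    refine Fin.cases ?_ (fun i => ?_) i <;> refine Fin.cases ?_ (fun j => ?_) j <;>
      simp [Matrix.vecMulVec_apply, Matrix.one_apply, Matrix.diagonal_apply, eq_comm]
  have h2 : ((bidiagonal c.1 c.2).transpose * bidiagonal c.1 c.2).map (fun t : ℝ => (t : ℂ)) =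
      ((bidiagonal c.1 c.2).map (fun t : ℝ => (t : ℂ))).transpose *
        (bidiagonal c.1 c.2).map (fun t : ℝ => (t : ℂ)) := by
    ext i j
    simp [Matrix.mul_apply]
  have h3 : (bidiagonal c.1 c.2).map (fun t : ℝ => (t : ℂ)) *
      (Matrix.diagonal (Fin.cons (1 + Complex.I * l) (fun _ => 1) : Fin (m + 1) → ℂ) *
        ((bidiagonal c.1 c.2).map (fun t : ℝ => (t : ℂ))).transpose) =
      weightedGram (1 + Complex.I * l) c := by
    ext i j
    simp [Matrix.mul_apply, weightedGram, Matrix.diagonal_apply, mul_assoc]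
  rw [perturbed, h1, h2, ← Matrix.mul_assoc, Matrix.charpoly_mul_comm, h3, charpoly_weightedGram,
    add_sub_cancel_left, polyF]

/-- The normalization constants of the squared entries. -/
def normConst (β : ℝ) (m n j : ℕ) : ℝ :=
  (2 : ℝ) ^ (β * ((m : ℝ) - (j + 1) + 1) / 2) * Real.Gamma (β * ((m : ℝ) - (j + 1) + 1) / 2) *
    ((2 : ℝ) ^ (β * ((n : ℝ) - (j + 1)) / 2) * Real.Gamma (β * ((n : ℝ) - (j + 1)) / 2))

theorem sum_range_sub_two_mul (a : ℝ) (k : ℕ) :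
    ∑ j ∈ Finset.range k, (a - 2 * (j : ℝ)) = k * (a - (k - 1)) := by
  induction k with
  | zero => simp
  | succ k ih =>
    rw [Finset.sum_range_succ, ih]
    push_cast
    ring

theorem prod_two_rpow (β : ℝ) (m n : ℕ) :
    ∏ j ∈ Finset.range m, ((2 : ℝ) ^ (β * ((m : ℝ) - (j + 1) + 1) / 2) *
      (2 : ℝ) ^ (β * ((n : ℝ) - (j + 1)) / 2)) = (2 : ℝ) ^ (β * m * n / 2) := by
  simp_rw [← Real.rpow_add two_pos]
  rw [← Real.rpow_sum_of_pos two_pos]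
  congr 1
  have h := sum_range_sub_two_mul ((m : ℝ) + n - 1) m
  have e : ∀ j : ℕ, β * ((m : ℝ) - (j + 1) + 1) / 2 + β * ((n : ℝ) - (j + 1)) / 2 =
      β / 2 * ((m : ℝ) + n - 1 - 2 * j) := fun j => by ring
  simp_rw [e, ← Finset.mul_sum]
  rw [h]
  ring

theorem prod_gamma_succ {β : ℝ} (hβ : 0 < β) (m : ℕ) :
    Real.Gamma (β / 2) ^ m * ∏ j ∈ Finset.range m,
      (Real.Gamma (1 + β * ((j : ℝ) + 1) / 2) / Real.Gamma (1 + β / 2)) =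
    m.factorial * ∏ j ∈ Finset.range m, Real.Gamma (β * ((m : ℝ) - (j + 1) + 1) / 2) := by
  have hG := Real.Gamma_pos_of_pos (half_pos hβ)
  have h1 : ∏ j ∈ Finset.range m, Real.Gamma (β * ((m : ℝ) - (j + 1) + 1) / 2) =
      ∏ j ∈ Finset.range m, Real.Gamma (β * ((j : ℝ) + 1) / 2) := by
    rw [← Finset.prod_range_reflect]
    refine Finset.prod_congr rfl fun j hj => ?_
    have hj' := Finset.mem_range.1 hj
    have : ((m - 1 - j : ℕ) : ℝ) = m - 1 - j := by
      rw [Nat.cast_sub (by omega), Nat.cast_sub (by omega)]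
      simp
    rw [this]
    congr 2
    ring
  have h2 : (m.factorial : ℝ) = ∏ j ∈ Finset.range m, ((j : ℝ) + 1) := by
    rw [← Finset.prod_range_add_one_eq_factorial]
    push_cast
    rfl
  have h3 : Real.Gamma (β / 2) ^ m = ∏ _j ∈ Finset.range m, Real.Gamma (β / 2) := by simp
  rw [h1, h2, h3, ← Finset.prod_mul_distrib, ← Finset.prod_mul_distrib]
  refine Finset.prod_congr rfl fun j _ => ?_
  have hj : 0 < β * ((j : ℝ) + 1) / 2 := by positivity
  rw [add_comm 1 (β * ((j : ℝ) + 1) / 2), add_comm 1 (β / 2), Real.Gamma_add_one hj.ne',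
    Real.Gamma_add_one (half_pos hβ).ne']
  field_simp

theorem prod_gamma_shift {β : ℝ} (hβ : 0 < β) {m n : ℕ} (hmn : m + 1 ≤ n) :
    (∏ j ∈ Finset.range m,
      Real.Gamma (1 + β * paramA β m n / 2 + β * (((j : ℝ) + 1) - 1) / 2)) *
      Real.Gamma (β * ((n : ℝ) - (m : ℝ)) / 2) / Real.Gamma (β * n / 2) =
    ∏ j ∈ Finset.range m, Real.Gamma (β * ((n : ℝ) - (j + 1)) / 2) := by
  have hn : 0 < (n : ℝ) := by exact_mod_cast (by omega : 0 < n)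
  have hmn' : (m : ℝ) + 1 ≤ n := by exact_mod_cast hmn
  have ha : 1 + β * paramA β m n / 2 = β * ((n : ℝ) - m + 1) / 2 := by
    rw [paramA, abs_of_nonpos (by linarith)]
    field_simp
    ring
  let h : ℕ → ℝ := fun i => Real.Gamma (β * ((n : ℝ) - m + i) / 2)
  have e1 : ∏ j ∈ Finset.range m,
      Real.Gamma (1 + β * paramA β m n / 2 + β * (((j : ℝ) + 1) - 1) / 2) =
      ∏ j ∈ Finset.range m, h (j + 1) := by
    refine Finset.prod_congr rfl fun j _ => ?_
    simp only [h]
    rw [ha]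
    push_cast
    congr 1
    ring
  have e2 : Real.Gamma (β * ((n : ℝ) - (m : ℝ)) / 2) = h 0 := by simp [h]
  have e3 : Real.Gamma (β * n / 2) = h m := by simp [h]
  have e4 : h m ≠ 0 := by
    rw [← e3]
    exact (Real.Gamma_pos_of_pos (by positivity)).ne'
  rw [e1, e2, e3, ← Finset.prod_range_succ', Finset.prod_range_succ, mul_div_cancel_right₀ _ e4,
    ← Finset.prod_range_reflect]
  refine Finset.prod_congr rfl fun j hj => ?_
  have hj' := Finset.mem_range.1 hj
  have : ((m - 1 - j : ℕ) : ℝ) = m - 1 - j := by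
    rw [Nat.cast_sub (by omega), Nat.cast_sub (by omega)]
    simp
  simp only [h]
  rw [this]
  congr 2
  ring

theorem constT_eq {β : ℝ} (hβ : 0 < β) {m n : ℕ} (hmn : m + 1 ≤ n) :
    constT β n m = m.factorial * ∏ j ∈ Finset.range m, normConst β m n j := by
  have hmn' : (m : ℝ) + 1 ≤ n := by exact_mod_cast hmn
  have h1 : ∏ j ∈ Finset.Icc 1 m, Real.Gamma (1 + β * (j : ℝ) / 2) *
      Real.Gamma (1 + β * paramA β m n / 2 + β * ((j : ℝ) - 1) / 2) / Real.Gamma (1 + β / 2) =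
      (∏ j ∈ Finset.range m,
        (Real.Gamma (1 + β * ((j : ℝ) + 1) / 2) / Real.Gamma (1 + β / 2))) *
      ∏ j ∈ Finset.range m,
        Real.Gamma (1 + β * paramA β m n / 2 + β * (((j : ℝ) + 1) - 1) / 2) := by
    rw [← Finset.Ico_add_one_right_eq_Icc, Finset.prod_Ico_eq_prod_range,
      ← Finset.prod_mul_distrib, Nat.add_sub_cancel]
    refine Finset.prod_congr rfl fun j _ => ?_
    push_cast
    rw [add_comm (1 : ℝ) (j : ℝ)]
    ring
  have h2 : (m : ℝ) * (paramA β m n * β / 2 + 1 + ((m : ℝ) - 1) * β / 2) = β * m * n / 2 := by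
    rw [paramA, abs_of_nonpos (by linarith)]
    field_simp
    ring
  have h3 := prod_two_rpow β m n
  have h4 := prod_gamma_succ hβ m
  have h5 := prod_gamma_shift hβ hmn
  have h6 : ∏ j ∈ Finset.range m, normConst β m n j =
      (∏ j ∈ Finset.range m, ((2 : ℝ) ^ (β * ((m : ℝ) - (j + 1) + 1) / 2) *
        (2 : ℝ) ^ (β * ((n : ℝ) - (j + 1)) / 2))) *
      (∏ j ∈ Finset.range m, Real.Gamma (β * ((m : ℝ) - (j + 1) + 1) / 2)) *
      ∏ j ∈ Finset.range m, Real.Gamma (β * ((n : ℝ) - (j + 1)) / 2) := by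
    simp_rw [← Finset.prod_mul_distrib]
    exact Finset.prod_congr rfl fun j _ => by rw [normConst]; ring
  rw [constT, h1, h2, h6, h3, ← h5]
  linear_combination ((2 : ℝ) ^ (β * m * n / 2)) * (∏ j ∈ Finset.range m,
    Real.Gamma (1 + β * paramA β m n / 2 + β * (((j : ℝ) + 1) - 1) / 2)) *
      Real.Gamma (β * ((n : ℝ) - (m : ℝ)) / 2) / Real.Gamma (β * n / 2) * h4

theorem normConst_pos {β : ℝ} (hβ : 0 < β) {m n : ℕ} (hmn : m + 1 ≤ n) {j : ℕ} (hj : j < m) :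
    0 < normConst β m n j := by
  have h1 : (j : ℝ) + 1 ≤ m := by exact_mod_cast hj
  have h2 : (m : ℝ) + 1 ≤ n := by exact_mod_cast hmn
  have g1 : 0 < β * ((m : ℝ) - (j + 1) + 1) / 2 :=
    half_pos (mul_pos hβ (by linarith))
  have g2 : 0 < β * ((n : ℝ) - (j + 1)) / 2 :=
    half_pos (mul_pos hβ (by linarith))
  have := Real.Gamma_pos_of_pos g1
  have := Real.Gamma_pos_of_pos g2
  unfold normConst
  positivity

theorem chiSqPdf_factor {β : ℝ} {m n : ℕ} {j : ℕ}
    (hj : j < m) (hN : 0 < normConst β m n j) {x y : ℝ} (hx : 0 < x) (hy : 0 < y) :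
    Real.exp (-x / 2) * Real.exp (-y / 2) * y ^ (β * ((n : ℝ) - (m : ℝ)) / 2 - 1) *
      (x ^ (m - j) * y ^ (m - 1 - j)) ^ (β / 2 - 1) =
    normConst β m n j * (chiSqPdf (β * ((m : ℝ) - (j + 1) + 1)) x *
      chiSqPdf (β * ((n : ℝ) - (j + 1))) y / (x ^ (m - 1 - j) * y ^ (m - 1 - j))) := by
  have c1 : ((m - j : ℕ) : ℝ) = m - j := by rw [Nat.cast_sub hj.le]
  have c2 : ((m - 1 - j : ℕ) : ℝ) = m - 1 - j := by
    rw [Nat.cast_sub (by omega), Nat.cast_sub (by omega)]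
    simp
  have e1 : (x ^ (m - j) * y ^ (m - 1 - j)) ^ (β / 2 - 1) =
      x ^ (((m : ℝ) - j) * (β / 2 - 1)) * y ^ (((m : ℝ) - 1 - j) * (β / 2 - 1)) := by
    rw [Real.mul_rpow (by positivity) (by positivity), ← Real.rpow_natCast x,
      ← Real.rpow_natCast y, ← Real.rpow_mul hx.le, ← Real.rpow_mul hy.le, c1, c2]
  have e2 : x ^ (((m : ℝ) - j) * (β / 2 - 1)) * x ^ (m - 1 - j) =
      x ^ (β * ((m : ℝ) - (j + 1) + 1) / 2 - 1) := by
    rw [← Real.rpow_natCast x, c2, ← Real.rpow_add hx]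
    congr 1
    ring
  have e3 : y ^ (β * ((n : ℝ) - (m : ℝ)) / 2 - 1) * y ^ (((m : ℝ) - 1 - j) * (β / 2 - 1)) *
      y ^ (m - 1 - j) = y ^ (β * ((n : ℝ) - (j + 1)) / 2 - 1) := by
    rw [← Real.rpow_natCast y, c2, ← Real.rpow_add hy, ← Real.rpow_add hy]
    congr 1
    ring
  have hx' : 0 < x ^ (m - 1 - j) := by positivity
  have hy' : 0 < y ^ (m - 1 - j) := by positivity
  have e4 : chiSqPdf (β * ((m : ℝ) - (j + 1) + 1)) x * chiSqPdf (β * ((n : ℝ) - (j + 1))) y =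
      x ^ (β * ((m : ℝ) - (j + 1) + 1) / 2 - 1) * Real.exp (-x / 2) *
        (y ^ (β * ((n : ℝ) - (j + 1)) / 2 - 1) * Real.exp (-y / 2)) / normConst β m n j := by
    rw [chiSqPdf, chiSqPdf, normConst, div_mul_div_comm]
  rw [e1, e4, ← e2, ← e3]
  field_simp

theorem density_eq {β : ℝ} (hβ : 0 < β) {m n : ℕ} (hmn : m + 1 ≤ n) {l : ℝ} (hl : 0 < l)
    {c : (Fin m → ℝ) × (Fin m → ℝ)} (hc : c ∈ posSet m) {z : Fin m → ℂ}
    (hz : rootPoly z = polyF l c) :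
    density β m n l z = (∏ j, ∏ k ∈ Finset.Ioi j, ‖z j - z k‖ ^ 2) *
      (pairPdf β m n c / (m.factorial * l ^ m)) := by
  have hsum := sum_re_roots (rootPoly_eq_polyF_iff.1 hz)
  have him := abs_im_sub_mul_re_prod hz
  have hres := prod_norm_sub_conj hz
  have hfac : (m.factorial : ℝ) ≠ 0 := by exact_mod_cast m.factorial_ne_zero
  have hN := fun j : Fin m => normConst_pos hβ hmn j.2
  have hNprod : 0 < ∏ j : Fin m, normConst β m n j := Finset.prod_pos fun j _ => hN j
  have d1 : Real.exp (-(∑ j, (z j).re) / 2) =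
      ∏ j, (Real.exp (-c.1 j / 2) * Real.exp (-c.2 j / 2)) := by
    rw [hsum, Finset.prod_mul_distrib, ← Real.exp_sum, ← Real.exp_sum, ← Real.exp_add,
      ← Finset.sum_div, ← Finset.sum_div, Finset.sum_neg_distrib, Finset.sum_neg_distrib]
    congr 1
    ring
  have d2 : |(∏ j, z j).im - l * (∏ j, z j).re| ^ (β * ((n : ℝ) - (m : ℝ)) / 2 - 1) =
      l ^ (β * ((n : ℝ) - (m : ℝ)) / 2 - 1) *
        ∏ j, c.2 j ^ (β * ((n : ℝ) - (m : ℝ)) / 2 - 1) := by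
    rw [him, abs_of_pos hl, Real.mul_rpow hl.le (Finset.prod_nonneg fun _ _ => abs_nonneg _),
      ← Real.finsetProd_rpow _ _ fun _ _ => abs_nonneg _]
    congr 1
    exact Finset.prod_congr rfl fun j _ => by rw [abs_of_pos (hc.2 j)]
  have d3 : ∏ j, ∏ k, ‖z j - (starRingEnd ℂ) (z k)‖ ^ (β / 2 - 1) =
      (2 : ℝ) ^ ((m : ℝ) * (β / 2 - 1)) * l ^ ((m : ℝ) * (β / 2 - 1)) *
        ∏ j, (c.1 j ^ (m - (j : ℕ)) * c.2 j ^ (m - 1 - (j : ℕ))) ^ (β / 2 - 1) := by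
    have : ∏ j, ∏ k, ‖z j - (starRingEnd ℂ) (z k)‖ ^ (β / 2 - 1) =
        (∏ j, ∏ k, ‖z j - (starRingEnd ℂ) (z k)‖) ^ (β / 2 - 1) := by
      rw [← Real.finsetProd_rpow _ _ fun _ _ => Finset.prod_nonneg fun _ _ => norm_nonneg _]
      exact Finset.prod_congr rfl fun j _ =>
        Real.finsetProd_rpow _ _ (fun _ _ => norm_nonneg _) _
    have hR : resultantNorm c = ∏ j, (c.1 j ^ (m - (j : ℕ)) * c.2 j ^ (m - 1 - (j : ℕ))) :=
      Finset.prod_congr rfl fun j _ => by rw [abs_of_pos (hc.1 j), abs_of_pos (hc.2 j)]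
    have hR0 : ∀ j ∈ (Finset.univ : Finset (Fin m)),
        0 ≤ c.1 j ^ (m - (j : ℕ)) * c.2 j ^ (m - 1 - (j : ℕ)) := fun j _ =>
      mul_nonneg (pow_nonneg (hc.1 j).le _) (pow_nonneg (hc.2 j).le _)
    rw [this, hres, hR, abs_of_pos hl, Real.mul_rpow (by positivity) (Finset.prod_nonneg hR0),
      ← Real.finsetProd_rpow _ _ hR0, ← Real.rpow_natCast, ← Real.rpow_mul (by positivity),
      Real.mul_rpow two_pos.le hl.le]
  have d4 : (∏ j : Fin m, (Real.exp (-c.1 j / 2) * Real.exp (-c.2 j / 2))) *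
      (∏ j, c.2 j ^ (β * ((n : ℝ) - (m : ℝ)) / 2 - 1)) *
      ∏ j : Fin m, (c.1 j ^ (m - (j : ℕ)) * c.2 j ^ (m - 1 - (j : ℕ))) ^ (β / 2 - 1) =
      (∏ j : Fin m, normConst β m n j) * pairPdf β m n c := by
    simp_rw [pairPdf, ← Finset.prod_mul_distrib]
    exact Finset.prod_congr rfl fun j _ => chiSqPdf_factor j.2 (hN j) (hc.1 j) (hc.2 j)
  have d5 : l ^ (1 - β * (n : ℝ) / 2) * l ^ (β * ((n : ℝ) - (m : ℝ)) / 2 - 1) *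
      l ^ ((m : ℝ) * (β / 2 - 1)) = (l ^ m)⁻¹ := by
    rw [← Real.rpow_add hl, ← Real.rpow_add hl, ← Real.rpow_natCast, ← Real.rpow_neg hl.le]
    congr 1
    ring
  have d6 : constC β m n = m.factorial * (∏ j : Fin m, normConst β m n j) *
      (2 : ℝ) ^ ((m : ℝ) * (β / 2 - 1)) := by
    rw [constC, constT_eq hβ hmn, Finset.prod_range]
  have h2 : (2 : ℝ) ^ ((m : ℝ) * (β / 2 - 1)) ≠ 0 := (Real.rpow_pos_of_pos two_pos _).ne'
  have hlm : l ^ m ≠ 0 := (pow_pos hl m).ne'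
  have hNp := hNprod.ne'
  rw [density, d1, d2, d3, d6]
  generalize (∏ j, ∏ k ∈ Finset.Ioi j, ‖z j - z k‖ ^ 2) = V
  generalize (2 : ℝ) ^ ((m : ℝ) * (β / 2 - 1)) = T at h2 ⊢
  generalize ∏ j : Fin m, normConst β m n j = N at d4 hNp ⊢
  calc _ = (l ^ (1 - β * (n : ℝ) / 2) * l ^ (β * ((n : ℝ) - (m : ℝ)) / 2 - 1) *
        l ^ ((m : ℝ) * (β / 2 - 1))) * ((∏ j : Fin m,
          (Real.exp (-c.1 j / 2) * Real.exp (-c.2 j / 2))) *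
        (∏ j, c.2 j ^ (β * ((n : ℝ) - (m : ℝ)) / 2 - 1)) *
        ∏ j : Fin m, (c.1 j ^ (m - (j : ℕ)) * c.2 j ^ (m - 1 - (j : ℕ))) ^ (β / 2 - 1)) *
        (T * V / (m.factorial * N * T)) := by ring
    _ = _ := by
      rw [d4, d5]
      field_simp

theorem density_comp_perm (β : ℝ) (m n : ℕ) (l : ℝ) (σ : Equiv.Perm (Fin m)) (z : Fin m → ℂ) :
    density β m n l (z ∘ σ) = density β m n l z := by
  have h1 : ∑ j, ((z ∘ σ) j).re = ∑ j, (z j).re := Equiv.sum_comp σ fun j => (z j).re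
  have h2 : ∏ j, (z ∘ σ) j = ∏ j, z j := Equiv.prod_comp σ z
  have h3 : ∏ j, ∏ k, ‖(z ∘ σ) j - (starRingEnd ℂ) ((z ∘ σ) k)‖ ^ (β / 2 - 1) =
      ∏ j, ∏ k, ‖z j - (starRingEnd ℂ) (z k)‖ ^ (β / 2 - 1) := by
    rw [← Equiv.prod_comp σ fun j => ∏ k, ‖z j - (starRingEnd ℂ) (z k)‖ ^ (β / 2 - 1)]
    refine Finset.prod_congr rfl fun j _ => ?_
    exact Equiv.prod_comp σ fun k => ‖z (σ j) - (starRingEnd ℂ) (z k)‖ ^ (β / 2 - 1)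
  have h4 : ∏ j, ∏ k ∈ Finset.Ioi j, ‖(z ∘ σ) j - (z ∘ σ) k‖ ^ 2 =
      ∏ j, ∏ k ∈ Finset.Ioi j, ‖z j - z k‖ ^ 2 := by
    rw [← prod_erase_norm, ← prod_erase_norm,
      ← Equiv.prod_comp σ fun j => ∏ k ∈ Finset.univ.erase j, ‖z j - z k‖]
    refine Finset.prod_congr rfl fun j _ => ?_
    refine Finset.prod_bij (fun k _ => σ k) (fun k hk => ?_) (fun a _ b _ h => σ.injective h)
      (fun k hk => ⟨σ.symm k, ?_, by simp⟩) (fun k _ => rfl)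
    · simpa using hk
    · have := Finset.ne_of_mem_erase hk
      simp only [Finset.mem_erase, Finset.mem_univ, and_true]
      intro h
      exact this (by rw [← h]; simp)
  rw [density, density, h1, h2, h3, h4]

theorem measurableSet_region (m : ℕ) (l : ℝ) : MeasurableSet (region m l) := by
  have h : region m l = (⋂ j : Fin m, {z | 0 < (z j).im}) ∩ {z | ∑ j, (z j).arg < Real.arctan l} := by
    ext z
    simp [region]
  rw [h]
  refine (MeasurableSet.iInter fun j => measurableSet_lt measurable_const (by fun_prop)).inter
    (measurableSet_lt (Finset.measurable_sum _ fun j _ => ?_) measurable_const)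
  exact Complex.measurable_arg.comp (measurable_pi_apply j)

theorem comp_perm_mem_region {m : ℕ} {l : ℝ} (σ : Equiv.Perm (Fin m)) (z : Fin m → ℂ) :
    z ∘ σ ∈ region m l ↔ z ∈ region m l := by
  have h2 : ∑ j, ((z ∘ σ) j).arg = ∑ j, (z j).arg := Equiv.sum_comp σ fun j => (z j).arg
  refine and_congr ⟨fun h j => ?_, fun h j => h (σ j)⟩ (by rw [h2])
  simpa using h (σ.symm j)

theorem measurable_density (β : ℝ) (m n : ℕ) (l : ℝ) : Measurable (density β m n l) := by
  unfold density
  refine ((((Measurable.mul measurable_const (by fun_prop)).mul ?_).mul ?_).mul ?_)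
  · have h : Measurable fun z : Fin m → ℂ => ∏ j, z j :=
      Finset.measurable_prod _ fun j _ => measurable_pi_apply j
    fun_prop
  · exact Finset.measurable_prod _ fun j _ => Finset.measurable_prod _ fun k _ => by fun_prop
  · exact Finset.measurable_prod _ fun j _ => Finset.measurable_prod _ fun k _ => by fun_prop

/-- The image of the ordered part of the region under `rootCoeffs` is, up to a null set, the set
of coefficients coming from positive entries. -/
theorem image_rootCoeffs_ae_eq {m : ℕ} {l : ℝ} (hl : 0 < l) :
    rootCoeffs '' (region m l ∩ orderedSet m) =ᵐ[volume] unmix l ⁻¹' pairSet m := by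
  have hsub : rootCoeffs '' (region m l ∩ orderedSet m) ⊆ unmix l ⁻¹' pairSet m := by
    rintro _ ⟨z, hz, rfl⟩
    exact unmix_rootCoeffs_mem_pairSet hl hz.1
  refine ae_eq_set.2 ⟨by simp [Set.sdiff_eq_empty.2 hsub], ?_⟩
  have hnull : volume (rootCoeffs '' tieSet m) = 0 :=
    addHaar_image_eq_zero_of_differentiableOn_of_addHaar_eq_zero (volume : Measure (Fin m → ℂ))
      (fun z _ => ((hasFDerivAt_rootCoeffs z).restrictScalars
        ℝ).differentiableAt.differentiableWithinAt) (volume_tieSet m)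
  refine measure_mono_null ?_ hnull
  rintro v ⟨⟨c, hc, hcv⟩, hv⟩
  have hvc : v = mixedCoeffs l (pairCoeffs m c) := by rw [hcv, mixedCoeffs_unmix hl.ne']
  obtain ⟨z, hz⟩ := exists_rootCoeffs_eq v
  refine ⟨z, ?_, hz⟩
  by_contra hn
  obtain ⟨σ, hσ⟩ := exists_perm_mem_orderedSet hn
  have hr := roots_mem_region hl hc (rootPoly_eq_polyF_iff.2 (hz.trans hvc))
  exact hv ⟨z ∘ σ, ⟨(comp_perm_mem_region σ z).2 hr, hσ⟩, by rw [rootCoeffs_comp_perm, hz]⟩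

/-- The coefficients of the nonzero part of the characteristic polynomial have the same law as
those of the polynomial with roots distributed by the density. -/
theorem map_coefficientLaw_eq {β : ℝ} (hβ : 0 < β) {m n : ℕ} (hmn : m + 1 ≤ n) {l : ℝ}
    (hl : 0 < l) :
    (coefficientLaw β m n).map (fun c => mixedCoeffs l (pairCoeffs m (squares c))) =
      (densityMeasure β m n l).map rootCoeffs := by
  have hmix := (continuous_mixedCoeffs (m := m) l).measurable
  have hun := (continuous_unmix (m := m) l).measurable
  have hpc := (continuous_pairCoeffs m).measurable
  have hsq : Measurable (squares (m := m)) := (measurePreserving_squares β m n).measurable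
  have hroot := (continuous_rootCoeffs (m := m)).measurable
  have hdens := (measurable_density β m n l).ennreal_ofReal
  have hU := (isOpen_pairSet m).measurableSet
  have hconst : 0 < (m.factorial * l ^ m : ℝ) := by positivity
  refine Measure.ext_of_lintegral _ fun h hh => ?_
  have hhr : Measurable fun z => h (rootCoeffs z) := hh.comp hroot
  have hW : Measurable fun q => ENNReal.ofReal (pairPdf β m n (paramOf m q)) :=
    ((measurable_pairPdf β m n).comp (measurable_paramOf m)).ennreal_ofReal
  have hF : Measurable fun c : (Fin m → ℝ) × (Fin m → ℝ) =>
      mixedCoeffs l (pairCoeffs m (squares c)) := hmix.comp (hpc.comp hsq)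
  rw [lintegral_map hh hF, lintegral_map hh hroot, densityMeasure,
    lintegral_withDensity_eq_lintegral_mul _ hdens hhr,
    lintegral_coefficientLaw hβ hmn (H := fun q => h (mixedCoeffs l q)) (hh.comp hmix),
    setLIntegral_eq_factorial_mul (measurableSet_region m l)
      (fun σ z => comp_perm_mem_region σ z) (fun σ z => by
        simp only [Pi.mul_apply]
        rw [density_comp_perm, rootCoeffs_comp_perm])]
  let K : (Fin m → ℝ) × (Fin m → ℝ) → ENNReal := fun q =>
    ENNReal.ofReal (m.factorial * l ^ m)⁻¹ *
      (ENNReal.ofReal (pairPdf β m n (paramOf m q)) * h (mixedCoeffs l q))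
  have hK : Measurable K := (hW.mul (hh.comp hmix)).const_mul _
  have hD : MeasurableSet (region m l ∩ orderedSet m) :=
    (measurableSet_region m l).inter (measurableSet_orderedSet m)
  have e1 : ∫⁻ z in region m l ∩ orderedSet m,
      ((fun z => ENNReal.ofReal (density β m n l z)) * fun z => h (rootCoeffs z)) z =
      ∫⁻ v in rootCoeffs '' (region m l ∩ orderedSet m), K (unmix l v) := by
    rw [lintegral_image_eq_lintegral_abs_det_fderiv_mul volume hD
      (fun z _ => ((hasFDerivAt_rootCoeffs z).restrictScalars ℝ).hasFDerivWithinAt)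
      (injOn_rootCoeffs.mono Set.inter_subset_right)]
    refine setLIntegral_congr_fun hD fun z hz => ?_
    have hinj : Function.Injective z := fun i j hij =>
      (hz.2 : StrictMono fun j => (z j).re).injective (by rw [hij])
    have hmem := unmix_rootCoeffs_mem_pairSet hl hz.1
    have hcz : rootPoly z = polyF l (paramOf m (unmix l (rootCoeffs z))) := by
      rw [rootPoly_eq_polyF_iff, pairCoeffs_paramOf hmem, mixedCoeffs_unmix hl.ne']
    simp only [Pi.mul_apply, K]
    rw [density_eq hβ hmn hl (paramOf_mem_posSet hmem) hcz, abs_det_rootDeriv hinj,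
      mixedCoeffs_unmix hl.ne', ENNReal.ofReal_mul (by positivity), div_eq_inv_mul,
      ENNReal.ofReal_mul (by positivity), mul_assoc, mul_assoc]
  rw [e1, setLIntegral_congr (image_rootCoeffs_ae_eq hl), ← lintegral_indicator (hun hU)]
  have e2 := lintegral_unmix hl (hK.indicator hU)
  have e3 : ∀ v : Fin m → ℂ, (unmix l ⁻¹' pairSet m).indicator (fun v => K (unmix l v)) v =
      (pairSet m).indicator K (unmix l v) := fun v => rfl
  simp_rw [e3]
  have hL : Measurable fun q =>
      ENNReal.ofReal (pairPdf β m n (paramOf m q)) * h (mixedCoeffs l q) := hW.mul (hh.comp hmix)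
  have e5 : ∫⁻ q in pairSet m, K q = ENNReal.ofReal (m.factorial * l ^ m)⁻¹ *
      ∫⁻ q in pairSet m, ENNReal.ofReal (pairPdf β m n (paramOf m q)) * h (mixedCoeffs l q) :=
    lintegral_const_mul _ hL
  rw [e2, lintegral_indicator hU, e5, ← mul_assoc, ← mul_assoc]
  have e4 : (m.factorial : ENNReal) * ENNReal.ofReal (l ^ m) *
      ENNReal.ofReal (m.factorial * l ^ m)⁻¹ = 1 := by
    rw [← ENNReal.ofReal_natCast, ← ENNReal.ofReal_mul (by positivity),
      ← ENNReal.ofReal_mul hconst.le, mul_inv_cancel₀ hconst.ne', ENNReal.ofReal_one]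
  rw [e4, one_mul]

/-! ### Measurability of the eigenvalues -/

theorem measurable_roots_monicOf (m : ℕ) :
    Measurable fun v : Fin m → ℂ => (monicOf v).roots := by
  intro A hA
  have hroot := (continuous_rootCoeffs (m := m)).measurable
  rw [← hroot.measurableSet_preimage_iff_of_surjective exists_rootCoeffs_eq]
  have : rootCoeffs ⁻¹' ((fun v : Fin m → ℂ => (monicOf v).roots) ⁻¹' A) =
      (fun z : Fin m → ℂ => configuration z) ⁻¹' A := by
    ext z
    simp only [Set.mem_preimage]
    rw [monicOf_rootCoeffs, roots_rootPoly]
  rw [this]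
  exact measurable_configuration m hA

theorem measurable_perturbed_apply {m : ℕ} (l : ℝ) (i j : Fin (m + 1)) :
    Measurable fun A : Matrix (Fin (m + 1)) (Fin (m + 1)) ℝ => perturbed l A i j := by
  have hentry : ∀ k, Measurable fun A : Matrix (Fin (m + 1)) (Fin (m + 1)) ℝ => A k j := fun k =>
    (measurable_pi_apply j).comp (measurable_pi_apply (X := fun _ => Fin (m + 1) → ℝ) k)
  simp only [perturbed, Matrix.mul_apply, Matrix.map_apply]
  exact Finset.measurable_sum _ fun k _ =>
    measurable_const.mul (Complex.measurable_ofReal.comp (hentry k))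

theorem measurable_charpoly_coeff_perturbed {m : ℕ} (l : ℝ) (k : ℕ) :
    Measurable fun A : Matrix (Fin (m + 1)) (Fin (m + 1)) ℝ => (perturbed l A).charpoly.coeff k := by
  have h : ∀ A : Matrix (Fin (m + 1)) (Fin (m + 1)) ℝ, (perturbed l A).charpoly.coeff k =
      MvPolynomial.eval (fun p : Fin (m + 1) × Fin (m + 1) => perturbed l A p.1 p.2)
        ((Matrix.charpoly.univ ℂ (Fin (m + 1))).coeff k) := fun A =>
    (Matrix.charpoly.univ_coeff_eval₂Hom (Fin (m + 1)) (RingHom.id ℂ)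
      (fun p : Fin (m + 1) × Fin (m + 1) => perturbed l A p.1 p.2) k).symm
  simp_rw [h]
  exact (MvPolynomial.continuous_eval _).measurable.comp
    (measurable_pi_lambda _ fun p => measurable_perturbed_apply l p.1 p.2)

/-- The roots of the characteristic polynomial of the perturbed matrix divided by `X`. -/
def reducedRoots {m : ℕ} (l : ℝ) (A : Matrix (Fin (m + 1)) (Fin (m + 1)) ℝ) : Multiset ℂ :=
  (monicOf fun k : Fin m => (perturbed l A).charpoly.coeff (k + 1)).roots

theorem measurable_reducedRoots {m : ℕ} (l : ℝ) : Measurable (reducedRoots (m := m) l) :=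
  (measurable_roots_monicOf m).comp
    (measurable_pi_lambda _ fun k => measurable_charpoly_coeff_perturbed l (k + 1))

/-- The Gram matrix of the bidiagonal matrix. -/
def gram {m : ℕ} (c : (Fin m → ℝ) × (Fin m → ℝ)) : Matrix (Fin (m + 1)) (Fin (m + 1)) ℝ :=
  (bidiagonal c.1 c.2).transpose * bidiagonal c.1 c.2

theorem reducedRoots_gram {m : ℕ} (l : ℝ) (c : (Fin m → ℝ) × (Fin m → ℝ)) :
    reducedRoots l (gram c) = (monicOf (mixedCoeffs l (pairCoeffs m (squares c)))).roots := by
  have h : (fun k : Fin m => (perturbed l (gram c)).charpoly.coeff (k + 1)) =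
      mixedCoeffs l (pairCoeffs m (squares c)) := funext fun k => by
    rw [gram, charpoly_perturbed, coeff_X_mul, polyF, ← monicOf_mixedCoeffs, coeff_monicOf]
  rw [reducedRoots, h]

theorem eigenvalues_perturbed_gram {m : ℕ} {l : ℝ} (hl : 0 < l) {c : (Fin m → ℝ) × (Fin m → ℝ)}
    (hc : squares c ∈ posSet m) :
    (eigenvalues (perturbed l (gram c))).count 0 = 1 ∧
      (∃ z ∈ region m l, (eigenvalues (perturbed l (gram c))).erase 0 = configuration z) ∧
      (eigenvalues (perturbed l (gram c))).erase 0 = reducedRoots l (gram c) := by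
  obtain ⟨z, hz⟩ := exists_rootCoeffs_eq (mixedCoeffs l (pairCoeffs m (squares c)))
  have hzF : rootPoly z = polyF l (squares c) := rootPoly_eq_polyF_iff.2 hz
  have hr := roots_mem_region hl hc hzF
  have he : eigenvalues (perturbed l (gram c)) = 0 ::ₘ configuration z := by
    rw [eigenvalues, gram, charpoly_perturbed, ← hzF,
      roots_mul (mul_ne_zero X_ne_zero (monic_rootPoly z).ne_zero), roots_X, roots_rootPoly]
    rfl
  have h0 : (0 : ℂ) ∉ configuration z := by
    simp only [configuration, Multiset.mem_map, not_exists, not_and]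
    intro j _ hj
    have := hr.1 j
    rw [hj] at this
    exact lt_irrefl _ this
  have hred : reducedRoots l (gram c) = configuration z := by
    rw [reducedRoots_gram, ← hz, monicOf_rootCoeffs, roots_rootPoly]
  rw [he, hred, Multiset.erase_cons_head, Multiset.count_cons_self,
    Multiset.count_eq_zero_of_notMem h0]
  exact ⟨rfl, ⟨z, hr, rfl⟩, rfl⟩

theorem continuous_gram {m : ℕ} : Continuous (gram (m := m)) := by
  have h : Continuous fun c : (Fin m → ℝ) × (Fin m → ℝ) => bidiagonal c.1 c.2 := by
    refine continuous_matrix fun i j => ?_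
    simp only [bidiagonal, Matrix.of_apply]
    split_ifs <;> fun_prop
  exact h.matrix_transpose.matrix_mul h

theorem measurableSet_gram_image (m : ℕ) :
    MeasurableSet (gram '' {c | squares c ∈ posSet m}) := by
  have hopen : IsOpen {c : (Fin m → ℝ) × (Fin m → ℝ) | squares c ∈ posSet m} := by
    have : {c : (Fin m → ℝ) × (Fin m → ℝ) | squares c ∈ posSet m} =
        ⋂ j : Fin m, ({c | 0 < c.1 j ^ 2} ∩ {c | 0 < c.2 j ^ 2}) := by
      ext c
      simp only [squares, posSet, Set.mem_ofPred_eq, Set.mem_iInter, Set.mem_inter_iff, forall_and]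
    rw [this]
    exact isOpen_iInter_of_finite fun j =>
      (isOpen_lt continuous_const (by fun_prop)).inter (isOpen_lt continuous_const (by fun_prop))
  have := hopen.locallyCompactSpace
  have hσ : IsSigmaCompact {c : (Fin m → ℝ) × (Fin m → ℝ) | squares c ∈ posSet m} :=
    isSigmaCompact_iff_sigmaCompactSpace.2 inferInstance
  obtain ⟨K, hK, hKU⟩ := hσ.image continuous_gram
  rw [← hKU]
  refine MeasurableSet.iUnion fun k => ?_
  have hclosed : IsClosed (X := Fin (m + 1) → Fin (m + 1) → ℝ) (K k) := (hK k).isClosed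
  exact hclosed.measurableSet

theorem ae_squares_mem_posSet (β : ℝ) (m n : ℕ) :
    ∀ᵐ c ∂(coefficientLaw β m n), squares c ∈ posSet m :=
  (measurePreserving_squares β m n).quasiMeasurePreserving.ae
    ((withDensity_absolutelyContinuous _ _).ae_le (ae_restrict_mem (measurableSet_posSet m)))

theorem ae_mem_gram_image (β : ℝ) (m n : ℕ) :
    ∀ᵐ A ∂(ensemble β m n), A ∈ gram '' {c | squares c ∈ posSet m} := by
  refine (ae_map_iff (measurable_bidiagonal_gram m).aemeasurable
    (measurableSet_gram_image m)).2 ?_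
  filter_upwards [ae_squares_mem_posSet β m n] with c hc
  exact ⟨c, hc, rfl⟩

theorem map_reducedRoots_ensemble {β : ℝ} (hβ : 0 < β) {m n : ℕ} (hmn : m + 1 ≤ n) {l : ℝ}
    (hl : 0 < l) :
    (ensemble β m n).map (reducedRoots l) = (densityMeasure β m n l).map configuration := by
  have hmix : Measurable fun c : (Fin m → ℝ) × (Fin m → ℝ) =>
      mixedCoeffs l (pairCoeffs m (squares c)) :=
    (continuous_mixedCoeffs (m := m) l).measurable.comp
      ((continuous_pairCoeffs m).measurable.comp (measurePreserving_squares β m n).measurable)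
  rw [ensemble, Measure.map_map (measurable_reducedRoots l) (measurable_bidiagonal_gram m)]
  have h1 : (reducedRoots l ∘ fun c : (Fin m → ℝ) × (Fin m → ℝ) =>
      (bidiagonal c.1 c.2).transpose * bidiagonal c.1 c.2) =
      (fun v : Fin m → ℂ => (monicOf v).roots) ∘
        fun c => mixedCoeffs l (pairCoeffs m (squares c)) :=
    funext fun c => reducedRoots_gram l c
  rw [h1, ← Measure.map_map (measurable_roots_monicOf m) hmix, map_coefficientLaw_eq hβ hmn hl,
    Measure.map_map (measurable_roots_monicOf m) continuous_rootCoeffs.measurable]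
  congr 1
  funext z
  simp only [Function.comp_apply]
  rw [monicOf_rootCoeffs, roots_rootPoly]

end LaguerreBeta

end

theorem theorem3p3 (β : ℝ) (hβ : 0 < β) (m n : ℕ) (hmn : m + 1 ≤ n) (l : ℝ) (hl : 0 < l)
    {Ω : Type*} [MeasurableSpace Ω] (P : Measure Ω) [IsProbabilityMeasure P]
    (J : Ω → Matrix (Fin (m + 1)) (Fin (m + 1)) ℝ)
    (hJ : HasLaw J (LaguerreBeta.ensemble β m n) P) :
    -- almost surely `0` is a simple eigenvalue, and the remaining ones lie in the region
    (∀ᵐ ω ∂P,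
      (LaguerreBeta.eigenvalues (LaguerreBeta.perturbed l (J ω))).count 0 = 1 ∧
      ∃ z ∈ LaguerreBeta.region m l,
        (LaguerreBeta.eigenvalues (LaguerreBeta.perturbed l (J ω))).erase 0 =
          LaguerreBeta.configuration z) ∧
    -- the density is that of a probability measure, invariant under relabelling
    IsProbabilityMeasure (LaguerreBeta.densityMeasure β m n l) ∧
    (∀ (σ : Equiv.Perm (Fin m)) (z : Fin m → ℂ),
      LaguerreBeta.density β m n l (z ∘ σ) = LaguerreBeta.density β m n l z) ∧
    -- the remaining eigenvalues, as an unordered configuration, are distributed as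
    -- `z₁, …, z_m` with this joint density
    HasLaw
      (fun ω => (LaguerreBeta.eigenvalues (LaguerreBeta.perturbed l (J ω))).erase 0)
      ((LaguerreBeta.densityMeasure β m n l).map LaguerreBeta.configuration) P := by
  have hgood : ∀ᵐ ω ∂P, J ω ∈ LaguerreBeta.gram '' {c | LaguerreBeta.squares c ∈
      LaguerreBeta.posSet m} := by
    refine ae_of_ae_map hJ.aemeasurable ?_
    rw [hJ.map_eq]
    exact LaguerreBeta.ae_mem_gram_image β m n
  have hmeas := LaguerreBeta.measurable_reducedRoots (m := m) l
  have hlaw : P.map (fun ω => LaguerreBeta.reducedRoots l (J ω)) =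
      (LaguerreBeta.densityMeasure β m n l).map LaguerreBeta.configuration := by
    rw [← LaguerreBeta.map_reducedRoots_ensemble hβ hmn hl, ← hJ.map_eq,
      AEMeasurable.map_map_of_aemeasurable hmeas.aemeasurable hJ.aemeasurable]
    rfl
  have hae : (fun ω => (LaguerreBeta.eigenvalues (LaguerreBeta.perturbed l (J ω))).erase 0)
      =ᵐ[P] fun ω => LaguerreBeta.reducedRoots l (J ω) := by
    filter_upwards [hgood] with ω hω
    obtain ⟨c, hc, hcω⟩ := hω
    rw [← hcω]
    exact (LaguerreBeta.eigenvalues_perturbed_gram hl hc).2.2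
  have hred : AEMeasurable (fun ω => LaguerreBeta.reducedRoots l (J ω)) P :=
    hmeas.comp_aemeasurable hJ.aemeasurable
  refine ⟨?_, ?_, LaguerreBeta.density_comp_perm β m n l, ⟨hred.congr hae.symm, ?_⟩⟩
  · filter_upwards [hgood] with ω hω
    obtain ⟨c, hc, hcω⟩ := hω
    rw [← hcω]
    obtain ⟨h1, h2, -⟩ := LaguerreBeta.eigenvalues_perturbed_gram hl hc
    exact ⟨h1, h2⟩
  · have h : IsProbabilityMeasure
        ((LaguerreBeta.densityMeasure β m n l).map LaguerreBeta.configuration) := by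
      rw [← hlaw]
      exact Measure.isProbabilityMeasure_map hred
    exact Measure.isProbabilityMeasure_of_map
      LaguerreBeta.configuration
  · rw [Measure.map_congr hae, hlaw]
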